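/- Let $d\in\mathbb N$, let $\rho=(\rho_{ij})\in\mathbb R^{d\times d}$ and $\sigma\in\mathbb R^d$ be such that the covariance matrix $Q=(\rho_{ij}\sigma_i\sigma_j)_{i,j=1}^d$ is (symmetric) positive definite, let $x_i^{\min}<x_i^{\max}$ be real numbers, $d_i=x_i^{\max}-x_i^{\min}$ $(i=1,\dots,d)$, let $r\in\mathbb R$ and $T>0$. Let $\Omega=(0,1)^d$, let $\langle\cdot,\cdot\rangle$ be the inner product of $L^2(\Omega)$, let $H_0^1(\Omega)$ be the closure of $C_c^\infty(\Omega)$ in $H^1(\Omega)$, and let $H^{-1}(\Omega)$ be its dual space, where $H_0^1(\Omega)$ is embedded into $H^{-1}(\Omega)$ by $u\mapsto\langle u,\cdot\rangle$. For $u,v\in H_0^1(\Omega)$ set $$a(u,v)=\sum_{i=1}^d\sum_{j=1}^d P_{i,j}\left\langle\frac{\partial u}{\partial x_i},\frac{\partial v}{\partial x_j}\right\rangle+r\langle u,v\rangle,\qquad P_{i,j}=\frac{\rho_{ij}\sigma_i\sigma_j}{2\,d_i d_j}.$$ Theorem. For every $u_0\in L^2(\Omega)$ there exists a unique $u\in L^2(0,T;H_0^1(\Omega))\cap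 H^1(0,T;H^{-1}(\Omega))$ such that, for almost every $t\in(0,T)$, $$\left\langle\frac{\partial u}{\partial t}(t),v\right\rangle+a(u(t),v)=0\quad\text{for all }v\in H_0^1(\Omega),\qquad\text{and}\qquad u(\cdot,0)=u_0 .$$ Here $\partial u/\partial t\in L^2(0,T;H^{-1}(\Omega))$ is the weak time derivative, the first bracket is the duality pairing of $H^{-1}(\Omega)$ with $H_0^1(\Omega)$, and the initial value is that of the representative of $u$ in $C([0,T];L^2(\Omega))$. -/

import Mathlib

open MeasureTheory Set TopologicalSpace
open scoped Distributions ENNReal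

noncomputable section

/-- Euclidean space `ℝ^d`. -/
abbrev EucSp (d : ℕ) : Type := EuclideanSpace ℝ (Fin d)

/-- The open unit cube `(0,1)^d`. -/
def unitCube (d : ℕ) : Opens (EucSp d) where
  carrier := {x | ∀ i, x i ∈ Ioo (0 : ℝ) 1}
  is_open' := by
    have h : {x : EucSp d | ∀ i, x i ∈ Ioo (0 : ℝ) 1} =
        ⋂ i : Fin d, (fun x : EucSp d => x i) ⁻¹' Ioo (0 : ℝ) 1 := by
      ext x; simp
    rw [h]
    exact isOpen_iInter_of_finite fun i => isOpen_Ioo.preimage (by fun_prop)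

/-- The open time interval `(0,T)`. -/
def timeInterval (T : ℝ) : Opens ℝ := ⟨Ioo 0 T, isOpen_Ioo⟩

/-- The real Hilbert space `L²(Ω)`. -/
abbrev L2 {d : ℕ} (Ω : Opens (EucSp d)) : Type :=
  Lp ℝ 2 (volume.restrict (Ω : Set (EucSp d)))

/-- `g` is the weak partial derivative `∂u/∂x_i` on `Ω`:
`∫_Ω u ∂_i φ = - ∫_Ω g φ` for all `φ ∈ C_c^∞(Ω)`. -/
def HasWeakPartial {d : ℕ} (Ω : Opens (EucSp d)) (i : Fin d) (u g : L2 Ω) : Prop :=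
  ∀ φ : 𝓓(Ω, ℝ),
    ∫ x in (Ω : Set (EucSp d)), u x * fderiv ℝ φ x (EuclideanSpace.single i 1) =
      -∫ x in (Ω : Set (EucSp d)), g x * φ x

/-- Smooth compactly supported functions (and continuous ones) pair integrably with `L²(Ω)`. -/
theorem L2.integrable_mul {d : ℕ} {Ω : Opens (EucSp d)} (u : L2 Ω) {f : EucSp d → ℝ}
    (hf : Continuous f) (hc : HasCompactSupport f) :
    Integrable (fun x => u x * f x) (volume.restrict (Ω : Set (EucSp d))) :=
  MemLp.integrable_mul (p := 2) (q := 2) (Lp.memLp u) (hf.memLp_of_hasCompactSupport hc)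

theorem L2.integrable_mul_test {d : ℕ} {Ω : Opens (EucSp d)} (u : L2 Ω) (φ : 𝓓(Ω, ℝ)) :
    Integrable (fun x => u x * φ x) (volume.restrict (Ω : Set (EucSp d))) :=
  u.integrable_mul φ.continuous φ.hasCompactSupport

theorem L2.integrable_mul_fderiv_test {d : ℕ} {Ω : Opens (EucSp d)} (u : L2 Ω) (φ : 𝓓(Ω, ℝ))
    (v : EucSp d) :
    Integrable (fun x => u x * fderiv ℝ φ x v) (volume.restrict (Ω : Set (EucSp d))) := by
  refine u.integrable_mul ?_ (φ.hasCompactSupport.fderiv_apply ℝ v)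
  exact (φ.contDiff.continuous_fderiv (by simp)).clm_apply continuous_const

/-- The space of pairs `(u, g)` in `L²(Ω) × L²(Ω)^d` such that `g` is the weak gradient of `u`,
with the norm `(‖u‖² + ∑ i, ‖g i‖²)^(1/2)`. -/
def weakGradientGraph {d : ℕ} (Ω : Opens (EucSp d)) :
    Submodule ℝ (WithLp 2 (L2 Ω × PiLp 2 (fun _ : Fin d => L2 Ω))) where
  carrier := {p | ∀ i, HasWeakPartial Ω i p.fst (p.snd i)}
  zero_mem' := by
    intro i φ
    have h := Lp.coeFn_zero ℝ 2 (volume.restrict (Ω : Set (EucSp d)))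
    have h1 : ∫ x in (Ω : Set (EucSp d)),
        (0 : L2 Ω) x * fderiv ℝ φ x (EuclideanSpace.single i 1) = 0 := by
      refine integral_eq_zero_of_ae ?_
      filter_upwards [h] with x hx
      rw [hx, Pi.zero_apply, zero_mul]
    have h2 : ∫ x in (Ω : Set (EucSp d)), (0 : L2 Ω) x * φ x = 0 := by
      refine integral_eq_zero_of_ae ?_
      filter_upwards [h] with x hx
      rw [hx, Pi.zero_apply, zero_mul]
    exact h1.trans (by rw [← neg_zero]; exact congrArg Neg.neg h2.symm)
  add_mem' := by
    intro p q hp hq i φ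
    have key : ∀ (a b : L2 Ω) (f : EucSp d → ℝ),
        Integrable (fun x => a x * f x) (volume.restrict (Ω : Set (EucSp d))) →
        Integrable (fun x => b x * f x) (volume.restrict (Ω : Set (EucSp d))) →
        ∫ x in (Ω : Set (EucSp d)), (a + b) x * f x =
          (∫ x in (Ω : Set (EucSp d)), a x * f x) + ∫ x in (Ω : Set (EucSp d)), b x * f x := by
      intro a b f ha hb
      rw [← integral_add ha hb]
      refine integral_congr_ae ?_
      filter_upwards [Lp.coeFn_add a b] with x hx
      rw [hx, Pi.add_apply, add_mul]
    have e1 := key p.fst q.fst (fun x => fderiv ℝ φ x (EuclideanSpace.single i 1))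
      (L2.integrable_mul_fderiv_test _ φ _) (L2.integrable_mul_fderiv_test _ φ _)
    have e2 := key (p.snd i) (q.snd i) φ
      (L2.integrable_mul_test _ φ) (L2.integrable_mul_test _ φ)
    have hp' := hp i φ
    have hq' := hq i φ
    simp only [WithLp.add_fst, WithLp.add_snd, PiLp.add_apply]
    rw [e1, e2, hp', hq']
    ring
  smul_mem' := by
    intro c p hp i φ
    have key : ∀ (a : L2 Ω) (f : EucSp d → ℝ),
        ∫ x in (Ω : Set (EucSp d)), (c • a) x * f x =
          c * ∫ x in (Ω : Set (EucSp d)), a x * f x := by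
      intro a f
      rw [← integral_const_mul]
      refine integral_congr_ae ?_
      filter_upwards [Lp.coeFn_smul c a] with x hx
      simp [hx, mul_assoc]
    have hp' := hp i φ
    simp only [WithLp.smul_fst, WithLp.smul_snd, PiLp.smul_apply]
    rw [key, key, hp']
    ring

/-- The Sobolev space `H¹(Ω)`. An element is a function `u ∈ L²(Ω)` stored together with its
weak gradient `(∂u/∂x_1, …, ∂u/∂x_d) ∈ L²(Ω)^d`, which `u` determines. The norm is given by
`‖u‖₁² = ‖u‖² + ∑ i, ‖∂u/∂x_i‖²`. -/
def H1 {d : ℕ} (Ω : Opens (EucSp d)) : Type := weakGradientGraph Ω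

instance H1.instNormedAddCommGroup {d : ℕ} (Ω : Opens (EucSp d)) :
    NormedAddCommGroup (H1 Ω) :=
  inferInstanceAs (NormedAddCommGroup (weakGradientGraph Ω))

instance H1.instInnerProductSpace {d : ℕ} (Ω : Opens (EucSp d)) :
    InnerProductSpace ℝ (H1 Ω) :=
  inferInstanceAs (InnerProductSpace ℝ (weakGradientGraph Ω))

/-- The inclusion `H¹(Ω) → L²(Ω)`. -/
def H1.toL2 {d : ℕ} (Ω : Opens (EucSp d)) : H1 Ω →L[ℝ] L2 Ω :=
  (WithLp.fstL 2 ℝ (L2 Ω) (PiLp 2 (fun _ : Fin d => L2 Ω))).comp (weakGradientGraph Ω).subtypeL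

/-- The weak partial derivative `∂/∂x_i : H¹(Ω) → L²(Ω)`. -/
def H1.weakPartial {d : ℕ} (Ω : Opens (EucSp d)) (i : Fin d) : H1 Ω →L[ℝ] L2 Ω :=
  (PiLp.proj 2 (𝕜 := ℝ) (fun _ : Fin d => L2 Ω) i).comp
    ((WithLp.sndL 2 ℝ (L2 Ω) (PiLp 2 (fun _ : Fin d => L2 Ω))).comp
      (weakGradientGraph Ω).subtypeL)

/-- The subspace `C_c^∞(Ω)` of `H¹(Ω)`. -/
def testSubspace {d : ℕ} (Ω : Opens (EucSp d)) : Submodule ℝ (H1 Ω) where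
  carrier := {u | ∃ φ : 𝓓(Ω, ℝ), H1.toL2 Ω u =ᵐ[volume.restrict (Ω : Set (EucSp d))] φ}
  zero_mem' := ⟨0, by
    rw [map_zero]
    simpa using Lp.coeFn_zero ℝ 2 (volume.restrict (Ω : Set (EucSp d)))⟩
  add_mem' := by
    rintro u v ⟨φ, hφ⟩ ⟨ψ, hψ⟩
    refine ⟨φ + ψ, ?_⟩
    rw [map_add]
    filter_upwards [Lp.coeFn_add (H1.toL2 Ω u) (H1.toL2 Ω v), hφ, hψ] with x hx h1 h2
    exact hx.trans (congrArg₂ (· + ·) h1 h2)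
  smul_mem' := by
    rintro c u ⟨φ, hφ⟩
    refine ⟨c • φ, ?_⟩
    rw [map_smul]
    filter_upwards [Lp.coeFn_smul c (H1.toL2 Ω u), hφ] with x hx h1
    simp [hx, h1]

/-- The Sobolev space `H_0^1(Ω)`: the closure of `C_c^∞(Ω)` in `H¹(Ω)`. -/
def H10 {d : ℕ} (Ω : Opens (EucSp d)) : Type :=
  (testSubspace Ω).topologicalClosure

/-- The norm `‖·‖₁` on `H_0^1(Ω)`, inherited from `H¹(Ω)`. -/
instance H10.instNormedAddCommGroup {d : ℕ} (Ω : Opens (EucSp d)) :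
    NormedAddCommGroup (H10 Ω) :=
  inferInstanceAs (NormedAddCommGroup (testSubspace Ω).topologicalClosure)

instance H10.instInnerProductSpace {d : ℕ} (Ω : Opens (EucSp d)) :
    InnerProductSpace ℝ (H10 Ω) :=
  inferInstanceAs (InnerProductSpace ℝ (testSubspace Ω).topologicalClosure)

/-- The inclusion `H_0^1(Ω) → H¹(Ω)`. -/
def H10.toH1 {d : ℕ} (Ω : Opens (EucSp d)) : H10 Ω →L[ℝ] H1 Ω :=
  (testSubspace Ω).topologicalClosure.subtypeL

/-- `H^{-1}(Ω)`, the dual space of `H_0^1(Ω)`. -/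
abbrev Hneg1 {d : ℕ} (Ω : Opens (EucSp d)) : Type := StrongDual ℝ (H10 Ω)

/-- The inclusion `H_0^1(Ω) → L²(Ω)`. -/
def toL2 {d : ℕ} (Ω : Opens (EucSp d)) : H10 Ω →L[ℝ] L2 Ω :=
  (H1.toL2 Ω).comp (H10.toH1 Ω)

/-- The weak partial derivative `∂u/∂x_i ∈ L²(Ω)` of `u ∈ H_0^1(Ω)`. -/
def weakPartial {d : ℕ} {Ω : Opens (EucSp d)} (i : Fin d) (u : H10 Ω) : L2 Ω :=
  H1.weakPartial Ω i (H10.toH1 Ω u)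

/-- The embedding `H_0^1(Ω) → H^{-1}(Ω)`, `u ↦ (v ↦ ⟨u, v⟩)` with the `L²(Ω)` inner product. -/
def toHneg1 {d : ℕ} {Ω : Opens (EucSp d)} (u : H10 Ω) : Hneg1 Ω :=
  (innerSL ℝ (toL2 Ω u)).comp (toL2 Ω)

/-- The Bochner space `L²(0,T;X)`. -/
abbrev BochnerL2 (T : ℝ) (X : Type) [NormedAddCommGroup X] : Type :=
  Lp X 2 (volume.restrict (timeInterval T : Set ℝ))

/-- `w ∈ L²(0,T;H^{-1}(Ω))` is the weak time derivative of `u ∈ L²(0,T;H_0^1(Ω))`. -/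
def HasWeakTimeDeriv {d : ℕ} {Ω : Opens (EucSp d)} {T : ℝ}
    (u : BochnerL2 T (H10 Ω)) (w : BochnerL2 T (Hneg1 Ω)) : Prop :=
  ∀ φ : 𝓓(timeInterval T, ℝ),
    ∫ t in (timeInterval T : Set ℝ), deriv φ t • toHneg1 (u t) =
      -∫ t in (timeInterval T : Set ℝ), φ t • w t

/-- The covariance matrix `Q` with entries `ρ_ij σ_i σ_j`. -/
def covarianceMatrix {d : ℕ} (ρ : Matrix (Fin d) (Fin d) ℝ) (σ : Fin d → ℝ) :
    Matrix (Fin d) (Fin d) ℝ :=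
  Matrix.of fun i j => ρ i j * σ i * σ j

/-- The coefficients `P_ij = ρ_ij σ_i σ_j / (2 d_i d_j)`, where `d_i = x_i^max - x_i^min`. -/
def coeffP {d : ℕ} (ρ : Matrix (Fin d) (Fin d) ℝ) (σ xmin xmax : Fin d → ℝ) :
    Matrix (Fin d) (Fin d) ℝ :=
  Matrix.of fun i j => ρ i j * σ i * σ j / (2 * (xmax i - xmin i) * (xmax j - xmin j))

/-- The bilinear form `a(u,v) = ∑ P_ij ⟨∂_i u, ∂_j v⟩ + r ⟨u, v⟩` on `H_0^1(Ω)`. -/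
def bilinForm {d : ℕ} {Ω : Opens (EucSp d)} (P : Matrix (Fin d) (Fin d) ℝ) (r : ℝ)
    (u v : H10 Ω) : ℝ :=
  (∑ i, ∑ j, P i j * inner ℝ (weakPartial i u) (weakPartial j v)) +
    r * inner ℝ (toL2 Ω u) (toL2 Ω v)

/-- `u ∈ L²(0,T;H_0^1(Ω)) ∩ H¹(0,T;H^{-1}(Ω))` solves
`⟨∂u/∂t, v⟩ + a(u, v) = 0` for all `v ∈ H_0^1(Ω)`, a.e. in `(0,T)`, and `u(·,0) = u₀`.
The initial value is that of the representative of `u` in `C([0,T];L²(Ω))`. -/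
structure IsVariationalSolution {d : ℕ} {Ω : Opens (EucSp d)} {T : ℝ}
    (P : Matrix (Fin d) (Fin d) ℝ) (r : ℝ) (u₀ : L2 Ω) (u : BochnerL2 T (H10 Ω)) : Prop where
  equation : ∃ w : BochnerL2 T (Hneg1 Ω), HasWeakTimeDeriv u w ∧
    ∀ᵐ t ∂(volume.restrict (timeInterval T : Set ℝ)),
      ∀ v : H10 Ω, w t v + bilinForm P r (u t) v = 0
  initial : ∃ c : ℝ → L2 Ω, ContinuousOn c (Icc 0 T) ∧
    (∀ᵐ t ∂(volume.restrict (timeInterval T : Set ℝ)), c t = toL2 Ω (u t)) ∧ c 0 = u₀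

end

/-! Write `V` for `H10 Ω`, `H` for `L2 Ω`, `i` for the dense injection `V → H`. Positive
definiteness of the covariance matrix gives a Gårding inequality for the form; multiplying solutions
by an exponential in time reduces existence to a coercive form `a`.

Existence. Lax-Milgram gives `R : H → V` with `a (R x) v = ⟪x, i v⟫`, so that `B = i ∘ R` is
bounded, accretive, of dense range, and formally the inverse of the unbounded operator `A` of the
form. Then `G = (B + ε)⁻¹` is a bounded operator, formally the Yosida approximation `A (1 + ε A)⁻¹`,
and its semigroup is an exponential series. As `ε → 0` the orbits converge uniformly on `[0,T]`
(`norm_exp_smul_neg_sub_le`, on the dense range of `B ∘ B`), and the functions `R G exp(-tG) x`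
converge in `L²(0,T;V)` by the energy bound `norm_toLp_orbitMap_le`. The limits are the continuous
representative and the solution.

Uniqueness. For the difference of two solutions, with primitive `U` of `u` and representative `c`,
the equation integrates to `⟪i v, c t⟫ = -a (U t) v`, by the scalar du Bois-Reymond lemma. Testing
with `v = U t` gives a Gronwall inequality for `‖i (U t)‖²`. Thus no product rule for the pairing of
`V` with its dual is needed (`weak_solution_eq_zero`). -/

/-! ### Semigroups and inverses of bounded accretive operators. -/

section AccretiveOperators

open Filter
open scoped Topology RealInnerProductSpace

variable {H : Type*} [NormedAddCommGroup H] [InnerProductSpace ℝ H]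

theorem hasDerivAt_exp_smul_apply [CompleteSpace H] (A : H →L[ℝ] H) (x : H) (t : ℝ) :
    HasDerivAt (fun s : ℝ => NormedSpace.exp (s • A) x) (A (NormedSpace.exp (t • A) x)) t := by
  simpa using (hasDerivAt_exp_smul_const' A t).clm_apply (hasDerivAt_const t x)

theorem continuous_exp_smul_apply [CompleteSpace H] (A : H →L[ℝ] H) (x : H) :
    Continuous fun s : ℝ => NormedSpace.exp (s • A) x :=
  continuous_iff_continuousAt.2 fun t => (hasDerivAt_exp_smul_apply A x t).continuousAt

/-- The energy identity for the semigroup generated by `-G`. -/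
theorem norm_sq_exp_smul_neg_apply [CompleteSpace H] (G : H →L[ℝ] H) (x : H) (t : ℝ) :
    ‖NormedSpace.exp (t • (-G)) x‖ ^ 2 +
      2 * ∫ s in (0 : ℝ)..t, ⟪G (NormedSpace.exp (s • (-G)) x), NormedSpace.exp (s • (-G)) x⟫ =
      ‖x‖ ^ 2 := by
  have hc := continuous_exp_smul_apply (-G) x
  have h := intervalIntegral.integral_eq_sub_of_hasDerivAt (a := 0) (b := t)
    (fun s _ => (hasDerivAt_exp_smul_apply (-G) x s).norm_sq)
    (Continuous.intervalIntegrable (by fun_prop) _ _)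
  simp only [neg_apply, inner_neg_right, mul_neg,
    intervalIntegral.integral_neg, intervalIntegral.integral_const_mul, zero_smul,
    NormedSpace.exp_zero, one_apply_eq_self] at h
  simp_rw [real_inner_comm (NormedSpace.exp (_ • (-G)) x)]
  linarith

theorem norm_exp_smul_neg_apply_le [CompleteSpace H] {G : H →L[ℝ] H}
    (hG : ∀ x, 0 ≤ ⟪G x, x⟫) {t : ℝ} (ht : 0 ≤ t)
    (x : H) : ‖NormedSpace.exp (t • (-G)) x‖ ≤ ‖x‖ := by
  have h := norm_sq_exp_smul_neg_apply G x t
  have h0 : 0 ≤ ∫ s in (0 : ℝ)..t,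
      ⟪G (NormedSpace.exp (s • (-G)) x), NormedSpace.exp (s • (-G)) x⟫ :=
    intervalIntegral.integral_nonneg ht fun s _ => hG _
  exact le_of_sq_le_sq (by linarith) (norm_nonneg _)

theorem commute_exp_smul_neg {G G' : H →L[ℝ] H} (h : Commute G G') (t : ℝ) :
    Commute G (NormedSpace.exp (t • (-G'))) :=
  ((h.neg_right).smul_right t).exp_right

/-- Duhamel estimate for the semigroups generated by two commuting accretive operators. -/
theorem norm_exp_smul_neg_sub_le [CompleteSpace H] {G G' : H →L[ℝ] H} (hG : ∀ x, 0 ≤ ⟪G x, x⟫)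
    (hG' : ∀ x, 0 ≤ ⟪G' x, x⟫) (hc : Commute G G') {t : ℝ} (ht : 0 ≤ t) (x : H) :
    ‖NormedSpace.exp (t • (-G)) x - NormedSpace.exp (t • (-G')) x‖ ≤ t * ‖(G - G') x‖ := by
  -- This path joins the two orbits at time `t`. By commutation its derivative is two contractions
  -- applied to `(G - G') x`.
  have hd : ∀ s : ℝ, HasDerivAt
      (fun s : ℝ => NormedSpace.exp ((t - s) • (-G')) (NormedSpace.exp (s • (-G)) x))
      (-NormedSpace.exp ((t - s) • (-G')) (NormedSpace.exp (s • (-G)) ((G - G') x))) s := by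
    intro s
    have h1 : HasDerivAt (fun s : ℝ => NormedSpace.exp ((t - s) • (-G')))
        (-(NormedSpace.exp ((t - s) • (-G')) * (-G'))) s := by
      have h0 := (hasDerivAt_exp_smul_const (-G') (t - s)).scomp s
        ((hasDerivAt_id s).const_sub t)
      rw [neg_one_smul] at h0
      exact h0
    refine (h1.clm_apply (hasDerivAt_exp_smul_apply (-G) x s)).congr_deriv ?_
    have e1 : G' (NormedSpace.exp (s • (-G)) x) = NormedSpace.exp (s • (-G)) (G' x) :=
      congrArg (fun A : H →L[ℝ] H => A x) (commute_exp_smul_neg hc.symm s).eq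
    have e2 : G (NormedSpace.exp (s • (-G)) x) = NormedSpace.exp (s • (-G)) (G x) :=
      congrArg (fun A : H →L[ℝ] H => A x) (commute_exp_smul_neg (Commute.refl G) s).eq
    rw [mul_neg, neg_neg, mul_apply_eq_comp, neg_apply, e1, e2, map_neg,
      sub_apply, map_sub, map_sub]
    abel
  have h := norm_image_sub_le_of_norm_deriv_le_segment' (f := fun s : ℝ =>
      NormedSpace.exp ((t - s) • (-G')) (NormedSpace.exp (s • (-G)) x)) (C := ‖(G - G') x‖)
    (fun s _ => (hd s).hasDerivWithinAt) (fun s hs => by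
      rw [norm_neg]
      exact (norm_exp_smul_neg_apply_le hG' (by linarith [hs.2]) _).trans
        (norm_exp_smul_neg_apply_le hG hs.1 _)) t (right_mem_Icc.2 ht)
  simpa [mul_comm] using h

/-- `B + ε` is invertible for accretive `B` and `ε > 0`. -/
theorem exists_inverse_add_smul [CompleteSpace H] {B : H →L[ℝ] H}
    (hB : ∀ x, 0 ≤ ⟪B x, x⟫) {ε : ℝ} (hε : 0 < ε) :
    ∃ G : H →L[ℝ] H, (∀ x, B (G x) + ε • G x = x) ∧ ∀ x, G (B x) + ε • G x = x := by
  let F : H →L[ℝ] H →L[ℝ] ℝ :=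
    (innerSL ℝ).comp (B + ε • ContinuousLinearMap.id ℝ H)
  have hF : ∀ v w, F v w = ⟪B v + ε • v, w⟫ := fun v w => rfl
  have hco : IsCoercive F := ⟨ε, hε, fun u => by
    rw [hF, inner_add_left, real_inner_smul_left, real_inner_self_eq_norm_mul_norm]
    linarith [hB u]⟩
  have key : ∀ v, hco.continuousLinearEquivOfBilin v = B v + ε • v := fun v =>
    (hco.unique_continuousLinearEquivOfBilin fun w => (hF v w).symm).symm
  refine ⟨hco.continuousLinearEquivOfBilin.symm, fun x => ?_, fun x => ?_⟩
  · rw [ContinuousLinearEquiv.coe_coe, ← key, ContinuousLinearEquiv.apply_symm_apply]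
  · rw [ContinuousLinearEquiv.coe_coe, ← map_smul, ← map_add, ← key,
      ContinuousLinearEquiv.symm_apply_apply]

section Inverse

variable {B G G' : H →L[ℝ] H} {ε ε' : ℝ}

theorem inner_inverse_nonneg (hB : ∀ x, 0 ≤ ⟪B x, x⟫) (hε : 0 < ε)
    (h1 : ∀ x, B (G x) + ε • G x = x) (x : H) : 0 ≤ ⟪G x, x⟫ := by
  have h : ⟪G x, x⟫ = ⟪G x, B (G x) + ε • G x⟫ := by rw [h1]
  rw [h, inner_add_right, real_inner_smul_right, real_inner_comm]
  have := hB (G x)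
  have := mul_nonneg hε.le (real_inner_self_nonneg (x := G x))
  linarith

/-- Pair `(B + ε) G x = x` with `G x` and drop the accretive term. -/
theorem norm_smul_inverse_le (hB : ∀ x, 0 ≤ ⟪B x, x⟫) (hε : 0 < ε)
    (h1 : ∀ x, B (G x) + ε • G x = x) (x : H) : ‖ε • G x‖ ≤ ‖x‖ := by
  have h : ⟪x, G x⟫ = ⟪B (G x) + ε • G x, G x⟫ := by rw [h1]
  rw [inner_add_left, real_inner_smul_left, real_inner_self_eq_norm_mul_norm] at h
  have h2 := real_inner_le_norm x (G x)
  have h3 := hB (G x)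
  rw [norm_smul, Real.norm_of_nonneg hε.le]
  rcases (norm_nonneg (G x)).eq_or_lt with h0 | h0
  · rw [← h0]; simp
  · exact le_of_mul_le_mul_right (by linarith) h0

/-- Since `G B = 1 - ε G`, the bound is uniform in `ε`, although `G` itself may blow up as `ε → 0`.
-/
theorem norm_inverse_apply_le (hB : ∀ x, 0 ≤ ⟪B x, x⟫) (hε : 0 < ε)
    (h1 : ∀ x, B (G x) + ε • G x = x) (h2 : ∀ x, G (B x) + ε • G x = x) (x : H) :
    ‖G (B x)‖ ≤ 2 * ‖x‖ := by
  rw [eq_sub_of_add_eq (h2 x)]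
  exact (norm_sub_le _ _).trans (by linarith [norm_smul_inverse_le hB hε h1 x])

theorem inverse_apply_comm (h1 : ∀ x, B (G x) + ε • G x = x) (h2 : ∀ x, G (B x) + ε • G x = x)
    (x : H) : G (B x) = B (G x) :=
  add_right_cancel ((h2 x).trans (h1 x).symm)

/-- The resolvent identity: the difference is of order `ε' - ε` wherever `G G'` stays bounded. -/
theorem inverse_sub_apply (h2 : ∀ x, G (B x) + ε • G x = x)
    (h1' : ∀ x, B (G' x) + ε' • G' x = x) (x : H) :
    (G - G') x = (ε' - ε) • G (G' x) := by
  have e1 : G x = G (B (G' x)) + ε' • G (G' x) := by rw [← map_smul, ← map_add, h1']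
  rw [sub_apply, e1, eq_sub_of_add_eq (h2 (G' x)), sub_smul]
  abel

theorem commute_inverse (h1 : ∀ x, B (G x) + ε • G x = x) (h2 : ∀ x, G (B x) + ε • G x = x)
    (h1' : ∀ x, B (G' x) + ε' • G' x = x) (h2' : ∀ x, G' (B x) + ε' • G' x = x) :
    Commute G G' := by
  refine ContinuousLinearMap.ext fun x => ?_
  change G (G' x) = G' (G x)
  calc G (G' x) = G (G' (B (G x) + ε • G x)) := by rw [h1]
    _ = G (B (G' (G x)) + ε • G' (G x)) := by
      rw [map_add, map_smul, inverse_apply_comm h1' h2']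
    _ = G' (G x) := by rw [map_add, map_smul, h2]

end Inverse

end AccretiveOperators

/-! ### Strong convergence of uniformly bounded operators from a dense set. -/

section DenseConvergence

open Filter
open scoped Topology

variable {X Y Z : Type*} [NormedAddCommGroup X] [NormedSpace ℝ X] [NormedAddCommGroup Y]
  [NormedSpace ℝ Y]

theorem cauchySeq_apply_of_denseRange {S : ℕ → X →L[ℝ] Y} {C : ℝ} (hS : ∀ n x, ‖S n x‖ ≤ C * ‖x‖)
    {f : Z → X} (hf : DenseRange f) (h : ∀ z, CauchySeq fun n => S n (f z)) (x : X) :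
    CauchySeq fun n => S n x := by
  rw [Metric.cauchySeq_iff']
  intro δ hδ
  -- `|C| + 1` replaces `C` so that one may divide without a sign assumption.
  have hC : 0 < |C| + 1 := by positivity
  obtain ⟨z, hz⟩ := hf.exists_dist_lt x (ε := δ / (3 * (|C| + 1))) (by positivity)
  obtain ⟨N, hN⟩ := Metric.cauchySeq_iff'.1 (h z) (δ / 3) (by positivity)
  have hb : ∀ n, dist (S n x) (S n (f z)) < δ / 3 := fun n => by
    rw [dist_eq_norm, ← map_sub]
    calc ‖S n (x - f z)‖ ≤ C * ‖x - f z‖ := hS n _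
      _ ≤ (|C| + 1) * ‖x - f z‖ := by gcongr; linarith [le_abs_self C]
      _ < (|C| + 1) * (δ / (3 * (|C| + 1))) := by rw [← dist_eq_norm]; gcongr
      _ = δ / 3 := by field_simp
  refine ⟨N, fun n hn => ?_⟩
  have h1 := dist_triangle4 (S n x) (S n (f z)) (S N (f z)) (S N x)
  have h2 := hb N
  rw [dist_comm] at h2
  linarith [hb n, hN n hn]

theorem tendsto_zero_apply_of_denseRange {S : ℕ → X →L[ℝ] Y} {C : ℝ}
    (hS : ∀ n x, ‖S n x‖ ≤ C * ‖x‖) {f : Z → X} (hf : DenseRange f)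
    (h : ∀ z, Tendsto (fun n => S n (f z)) atTop (𝓝 0)) (x : X) :
    Tendsto (fun n => S n x) atTop (𝓝 0) := by
  rw [Metric.tendsto_atTop]
  intro δ hδ
  have hC : 0 < |C| + 1 := by positivity
  obtain ⟨z, hz⟩ := hf.exists_dist_lt x (ε := δ / (2 * (|C| + 1))) (by positivity)
  obtain ⟨N, hN⟩ := Metric.tendsto_atTop.1 (h z) (δ / 2) (by positivity)
  refine ⟨N, fun n hn => ?_⟩
  have hb : dist (S n x) (S n (f z)) < δ / 2 := by
    rw [dist_eq_norm, ← map_sub]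
    calc ‖S n (x - f z)‖ ≤ C * ‖x - f z‖ := hS n _
      _ ≤ (|C| + 1) * ‖x - f z‖ := by gcongr; linarith [le_abs_self C]
      _ < (|C| + 1) * (δ / (2 * (|C| + 1))) := by rw [← dist_eq_norm]; gcongr
      _ = δ / 2 := by field_simp
  linarith [dist_triangle (S n x) (S n (f z)) 0, hN n hn]

end DenseConvergence

/-! ### Time integrals, orbits, and estimates for the approximate problems. -/

section WeakSolution

open Filter
open scoped Topology RealInnerProductSpace BoundedContinuousFunction

theorem coe_timeInterval (T : ℝ) : (timeInterval T : Set ℝ) = Ioo 0 T := rfl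

instance isFiniteMeasure_restrict_timeInterval (T : ℝ) :
    IsFiniteMeasure (volume.restrict (timeInterval T : Set ℝ)) := by
  rw [coe_timeInterval]; infer_instance

theorem integral_timeInterval {E : Type*} [NormedAddCommGroup E] [NormedSpace ℝ E] {T : ℝ}
    (hT : 0 ≤ T) (f : ℝ → E) :
    ∫ t in (timeInterval T : Set ℝ), f t = ∫ t in (0 : ℝ)..T, f t := by
  rw [coe_timeInterval, intervalIntegral.integral_of_le hT, integral_Ioc_eq_integral_Ioo]

theorem ae_mem_timeInterval (T : ℝ) :
    ∀ᵐ t ∂(volume.restrict (timeInterval T : Set ℝ)), t ∈ Ioo 0 T :=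
  ae_restrict_mem measurableSet_Ioo

theorem exists_bound_timeInterval {E : Type*} [NormedAddCommGroup E] {f : ℝ → E}
    (hf : Continuous f) (T : ℝ) :
    ∃ C, ∀ᵐ t ∂(volume.restrict (timeInterval T : Set ℝ)), ‖f t‖ ≤ C := by
  obtain ⟨C, hC⟩ := isCompact_Icc.exists_bound_of_continuousOn (hf.continuousOn (s := Icc 0 T))
  exact ⟨C, (ae_mem_timeInterval T).mono fun t ht => hC t (Ioo_subset_Icc_self ht)⟩

theorem memLp_timeInterval_of_continuous {E : Type*} [NormedAddCommGroup E] {f : ℝ → E}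
    (hf : Continuous f) (T : ℝ) (p : ℝ≥0∞) :
    MemLp f p (volume.restrict (timeInterval T : Set ℝ)) := by
  obtain ⟨C, hC⟩ := exists_bound_timeInterval hf T
  exact .of_bound hf.aestronglyMeasurable C hC

/-- With `y` the Riesz representative of `l`, the integral is an inner product in `L²(0,T;X)` with
`t ↦ ψ t • y`. -/
theorem tendsto_integral_mul_dual {X : Type*} [NormedAddCommGroup X] [InnerProductSpace ℝ X]
    [CompleteSpace X] {T : ℝ} {ψ : ℝ → ℝ} (hψ : Continuous ψ) (l : StrongDual ℝ X)
    {f : ℕ → Lp X 2 (volume.restrict (timeInterval T : Set ℝ))}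
    {g : Lp X 2 (volume.restrict (timeInterval T : Set ℝ))} (h : Tendsto f atTop (𝓝 g)) :
    Tendsto (fun n => ∫ t in (timeInterval T : Set ℝ), ψ t * l (f n t)) atTop
      (𝓝 (∫ t in (timeInterval T : Set ℝ), ψ t * l (g t))) := by
  let y := (InnerProductSpace.toDual ℝ X).symm l
  have hm := memLp_timeInterval_of_continuous (hψ.smul (continuous_const (y := y))) T 2
  have key : ∀ k : Lp X 2 (volume.restrict (timeInterval T : Set ℝ)),
      ⟪hm.toLp, k⟫ = ∫ t in (timeInterval T : Set ℝ), ψ t * l (k t) := fun k => by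
    rw [L2.inner_def]
    refine integral_congr_ae ?_
    filter_upwards [hm.coeFn_toLp] with t ht
    rw [ht, Pi.smul_apply', real_inner_smul_left, InnerProductSpace.toDual_symm_apply]
  simp_rw [← key]
  exact tendsto_const_nhds.inner h

/-- The orbits on `[0,T]` of the semigroup generated by `-G`, extended to `ℝ` by constants. -/
noncomputable def orbitMap {H : Type*} [NormedAddCommGroup H] [InnerProductSpace ℝ H]
    [CompleteSpace H]
    (G : H →L[ℝ] H) (hG : ∀ x, 0 ≤ ⟪G x, x⟫) (T : ℝ) : H →L[ℝ] (ℝ →ᵇ H) :=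
  LinearMap.mkContinuous
    ({ toFun := fun x => BoundedContinuousFunction.ofNormedAddCommGroup
        -- Clamping the time to `[0,T]` avoids negative times, where the contraction bound is
        -- unavailable.
        (fun t => NormedSpace.exp ((max 0 (min t T)) • (-G)) x)
        ((continuous_exp_smul_apply (-G) x).comp (by fun_prop)) ‖x‖
        fun _ => norm_exp_smul_neg_apply_le hG (le_max_left _ _) x
       map_add' := fun x y => by ext t; simp
       map_smul' := fun c x => by ext t; simp } : H →ₗ[ℝ] (ℝ →ᵇ H)) 1
    fun x => by
      rw [one_mul]
      exact (BoundedContinuousFunction.norm_le (norm_nonneg x)).2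
        fun _ => norm_exp_smul_neg_apply_le hG (le_max_left _ _) x

section OrbitMap

variable {H : Type*} [NormedAddCommGroup H] [InnerProductSpace ℝ H] [CompleteSpace H]
  {G G' : H →L[ℝ] H} (hG : ∀ x, 0 ≤ ⟪G x, x⟫) (hG' : ∀ x, 0 ≤ ⟪G' x, x⟫) {T : ℝ}

theorem orbitMap_apply (x : H) (t : ℝ) :
    orbitMap G hG T x t = NormedSpace.exp ((max 0 (min t T)) • (-G)) x := rfl

theorem orbitMap_apply_of_mem {t : ℝ} (ht : t ∈ Icc 0 T) (x : H) :
    orbitMap G hG T x t = NormedSpace.exp (t • (-G)) x := by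
  rw [orbitMap_apply, min_eq_left ht.2, max_eq_right ht.1]

theorem norm_orbitMap_le (x : H) : ‖orbitMap G hG T x‖ ≤ ‖x‖ :=
  (BoundedContinuousFunction.norm_le (norm_nonneg x)).2
    fun _ => norm_exp_smul_neg_apply_le hG (le_max_left _ _) x

theorem norm_orbitMap_sub_le (hc : Commute G G') (hT : 0 ≤ T) (x : H) :
    ‖orbitMap G hG T x - orbitMap G' hG' T x‖ ≤ T * ‖(G - G') x‖ := by
  refine (BoundedContinuousFunction.norm_le (by positivity)).2 fun t => ?_
  refine (norm_exp_smul_neg_sub_le hG hG' hc (le_max_left _ _) x).trans ?_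
  gcongr
  exact max_le hT (min_le_right _ _)

theorem map_orbitMap (x : H) (t : ℝ) :
    G (orbitMap G hG T x t) = orbitMap G hG T (G x) t :=
  congrArg (fun A : H →L[ℝ] H => A x) (commute_exp_smul_neg (Commute.refl G) _).eq

end OrbitMap

variable {V H : Type*} [NormedAddCommGroup V] [InnerProductSpace ℝ V]
  [NormedAddCommGroup H] [InnerProductSpace ℝ H] [CompleteSpace H]

/-- Lax-Milgram: the solution operator `H → V` of `a(u, v) = ⟨f, v⟩`. -/
theorem exists_solution_operator [CompleteSpace V] (i : V →L[ℝ] H) (a : V →L[ℝ] V →L[ℝ] ℝ)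
    {α : ℝ} (hα : 0 < α) (ha : ∀ v, α * ‖v‖ ^ 2 ≤ a v v) : ∃ R : H →L[ℝ] V, ∀ x v, a (R x) v = ⟪x, i v⟫ := by
  have hco : IsCoercive a := ⟨α, hα, fun u => by
    rw [mul_assoc, ← sq]; exact ha u⟩
  refine ⟨(hco.continuousLinearEquivOfBilin.symm : V →L[ℝ] V).comp i.adjoint, fun x v => ?_⟩
  rw [← hco.continuousLinearEquivOfBilin_apply, ContinuousLinearMap.comp_apply,
    ContinuousLinearEquiv.coe_coe, ContinuousLinearEquiv.apply_symm_apply,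
    ContinuousLinearMap.adjoint_inner_left]

theorem denseRange_of_forall_inner_eq_zero {X : Type*} [NormedAddCommGroup X] [NormedSpace ℝ X]
    {L : X →L[ℝ] H} (h : ∀ x, (∀ v, ⟪x, L v⟫ = 0) → x = 0) : DenseRange L := by
  have h0 : L.rangeᗮ = ⊥ := by
    rw [Submodule.eq_bot_iff]
    exact fun x hx => h x fun v => by
      rw [real_inner_comm]
      exact hx _ ⟨v, rfl⟩
  have := Submodule.topologicalClosure_eq_top_iff.2 h0
  exact fun x => by
    have hx : x ∈ L.range.topologicalClosure := this ▸ Submodule.mem_top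
    rw [← SetLike.mem_coe, Submodule.topologicalClosure_coe, LinearMap.coe_range] at hx
    exact hx

section Approximation

variable {i : V →L[ℝ] H} {a : V →L[ℝ] V →L[ℝ] ℝ} {α : ℝ} {R : H →L[ℝ] V} {T : ℝ}

/-- If `x` is orthogonal to the range, then `a (R x) (R x) = 0`, so `R x = 0` by coercivity. Hence
`x` is orthogonal to the dense range of `i`. -/
theorem denseRange_comp_solution_operator (hi : DenseRange i) (hα : 0 < α)
    (ha : ∀ v, α * ‖v‖ ^ 2 ≤ a v v) (hR : ∀ x v, a (R x) v = ⟪x, i v⟫) :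
    DenseRange (i.comp R) := by
  refine denseRange_of_forall_inner_eq_zero fun x hx => ?_
  have h0 : a (R x) (R x) = 0 := (hR x (R x)).trans (hx x)
  have h1 : R x = 0 := by
    have := ha (R x)
    rw [h0] at this
    have h2 : ‖R x‖ ^ 2 ≤ 0 := nonpos_of_mul_nonpos_right this hα
    exact norm_eq_zero.1 (pow_eq_zero_iff two_ne_zero |>.1 (le_antisymm h2 (sq_nonneg _)))
  refine hi.eq_zero_of_inner_left (𝕜 := ℝ) fun v => ?_
  rw [← hR, h1, map_zero, zero_apply]

/-- The a priori bound in `L²(0,T;V)`, uniform in `ε`: coercivity gives `α ‖R G y‖² ≤ ⟪G y, y⟫`, and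
the energy identity bounds the time integral of the right side along an orbit by `‖x‖² / 2`. -/
theorem norm_toLp_orbitMap_le {G : H →L[ℝ] H} {ε : ℝ} (hT : 0 ≤ T) (hα : 0 < α)
    (ha : ∀ v, α * ‖v‖ ^ 2 ≤ a v v) (hR : ∀ x v, a (R x) v = ⟪x, i v⟫) (hε : 0 < ε)
    (h1 : ∀ x, (i.comp R) (G x) + ε • G x = x) (hG : ∀ x, 0 ≤ ⟪G x, x⟫) (x : H) :
    ‖BoundedContinuousFunction.toLp 2 (volume.restrict (timeInterval T : Set ℝ)) ℝ
      ((R.comp G).compLeftContinuousBounded ℝ (orbitMap G hG T x))‖ ≤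
      Real.sqrt (1 / (2 * α)) * ‖x‖ := by
  have hen := norm_sq_exp_smul_neg_apply G x T
  set f := BoundedContinuousFunction.toLp 2 (volume.restrict (timeInterval T : Set ℝ)) ℝ
      ((R.comp G).compLeftContinuousBounded ℝ (orbitMap G hG T x)) with hf
  have hpt : ∀ y, α * ‖R (G y)‖ ^ 2 ≤ ⟪G y, y⟫ := fun y => by
    have e : ⟪G y, y⟫ = ⟪G y, i (R (G y)) + ε • G y⟫ := by
      rw [show i (R (G y)) + ε • G y = y from h1 y]
    rw [e, inner_add_right, ← hR, real_inner_smul_right]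
    have := mul_nonneg hε.le (real_inner_self_nonneg (x := G y))
    linarith [ha (R (G y))]
  have hsq : α * ‖f‖ ^ 2 = ∫ t in (0 : ℝ)..T, α * ‖R (G (NormedSpace.exp (t • (-G)) x))‖ ^ 2 := by
    rw [← real_inner_self_eq_norm_sq, L2.inner_def, ← integral_timeInterval hT,
      ← integral_const_mul]
    refine integral_congr_ae ?_
    filter_upwards [ae_mem_timeInterval T, BoundedContinuousFunction.coeFn_toLp 2
      (volume.restrict (timeInterval T : Set ℝ)) ℝ
      ((R.comp G).compLeftContinuousBounded ℝ (orbitMap G hG T x))] with t ht hft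
    rw [hf, hft, real_inner_self_eq_norm_sq, ContinuousLinearMap.compLeftContinuousBounded_apply,
      orbitMap_apply_of_mem hG (Ioo_subset_Icc_self ht)]
    rfl
  have hc := continuous_exp_smul_apply (-G) x
  have hle : α * ‖f‖ ^ 2 ≤ ∫ t in (0 : ℝ)..T,
      ⟪G (NormedSpace.exp (t • (-G)) x), NormedSpace.exp (t • (-G)) x⟫ := by
    rw [hsq]
    exact intervalIntegral.integral_mono hT (Continuous.intervalIntegrable (by fun_prop) _ _)
      (Continuous.intervalIntegrable (by fun_prop) _ _) fun t => hpt _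
  refine le_of_sq_le_sq ?_ (by positivity)
  rw [mul_pow, Real.sq_sqrt (by positivity)]
  rw [div_mul_eq_mul_div, one_mul, le_div_iff₀ (by positivity)]
  nlinarith [sq_nonneg ‖NormedSpace.exp (T • (-G)) x‖]

/-- The approximate orbits satisfy the weak equation exactly, because `⟪G y, i v⟫ = a (R (G y)) v`.
The class of `C¹` functions vanishing at `0` and `T` is stable under the later multiplication by
exponentials. -/
theorem integral_deriv_mul_orbitMap {G : H →L[ℝ] H} (hT : 0 ≤ T)
    (hR : ∀ x v, a (R x) v = ⟪x, i v⟫) (hG : ∀ x, 0 ≤ ⟪G x, x⟫) (x : H) {φ : ℝ → ℝ}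
    (hφ : ContDiff ℝ 1 φ) (h0 : φ 0 = 0) (hφT : φ T = 0) (v : V) :
    ∫ t in (timeInterval T : Set ℝ), deriv φ t * ⟪i v, orbitMap G hG T x t⟫ =
      ∫ t in (timeInterval T : Set ℝ),
        φ t * a ((R.comp G).compLeftContinuousBounded ℝ (orbitMap G hG T x) t) v := by
  have hc := continuous_exp_smul_apply (-G) x
  have hd : ∀ t, HasDerivAt (fun t : ℝ => ⟪i v, NormedSpace.exp (t • (-G)) x⟫)
      (-⟪i v, G (NormedSpace.exp (t • (-G)) x)⟫) t := fun t => by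
    simpa using (hasDerivAt_const t (i v)).inner ℝ (hasDerivAt_exp_smul_apply (-G) x t)
  have hφ' : ∀ t, HasDerivAt φ (deriv φ t) t := fun t =>
    (hφ.differentiable (by simp) t).hasDerivAt
  have key := intervalIntegral.integral_mul_deriv_eq_deriv_mul (a := 0) (b := T)
    (fun t _ => hφ' t) (fun t _ => hd t)
    ((hφ.continuous_deriv le_rfl).intervalIntegrable _ _)
    (Continuous.intervalIntegrable (by fun_prop) _ _)
  rw [h0, hφT, zero_mul, zero_mul, sub_zero, zero_sub, ← integral_timeInterval hT,
    ← integral_timeInterval hT] at key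
  simp_rw [mul_neg] at key
  rw [integral_neg, neg_inj] at key
  have e1 : ∫ t in (timeInterval T : Set ℝ), deriv φ t * ⟪i v, orbitMap G hG T x t⟫ =
      ∫ t in (timeInterval T : Set ℝ), deriv φ t * ⟪i v, NormedSpace.exp (t • (-G)) x⟫ := by
    refine integral_congr_ae ((ae_mem_timeInterval T).mono fun t ht => ?_)
    simp only [orbitMap_apply_of_mem hG (Ioo_subset_Icc_self ht)]
  rw [e1, ← key]
  refine integral_congr_ae ((ae_mem_timeInterval T).mono fun t ht => ?_)
  simp only [ContinuousLinearMap.compLeftContinuousBounded_apply, ContinuousLinearMap.comp_apply,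
    orbitMap_apply_of_mem hG (Ioo_subset_Icc_self ht), hR]
  rw [real_inner_comm]

end Approximation

end WeakSolution

/-! ### Existence for a coercive form. -/

section Existence

open Filter
open scoped Topology RealInnerProductSpace BoundedContinuousFunction

variable {V H : Type*} [NormedAddCommGroup V] [InnerProductSpace ℝ V] [CompleteSpace V]
  [NormedAddCommGroup H] [InnerProductSpace ℝ H] [CompleteSpace H]

theorem exists_weak_solution_of_coercive {i : V →L[ℝ] H} (hi : DenseRange i)
    {a : V →L[ℝ] V →L[ℝ] ℝ} {α T : ℝ} (hα : 0 < α) (ha : ∀ v, α * ‖v‖ ^ 2 ≤ a v v) (hT : 0 ≤ T)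
    (x : H) :
    ∃ (c : ℝ →ᵇ H) (u : Lp V 2 (volume.restrict (timeInterval T : Set ℝ))), c 0 = x ∧
      (∀ᵐ t ∂(volume.restrict (timeInterval T : Set ℝ)), c t = i (u t)) ∧
      ∀ φ : ℝ → ℝ, ContDiff ℝ 1 φ → φ 0 = 0 → φ T = 0 → ∀ v,
        ∫ t in (timeInterval T : Set ℝ), deriv φ t * ⟪i v, c t⟫ =
          ∫ t in (timeInterval T : Set ℝ), φ t * a (u t) v := by
  obtain ⟨R, hR⟩ := exists_solution_operator i a hα ha
  set B := i.comp R
  have hBd : DenseRange B := denseRange_comp_solution_operator hi hα ha hR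
  have hB : ∀ y, 0 ≤ ⟪B y, y⟫ := fun y => by
    have h : ⟪B y, y⟫ = a (R y) (R y) := by rw [hR, real_inner_comm]; rfl
    rw [h]
    exact le_trans (by positivity) (ha _)
  let ε : ℕ → ℝ := fun n => 1 / ((n : ℝ) + 1)
  have hε : ∀ n, 0 < ε n := fun n => Nat.one_div_pos_of_nat
  have hε0 : Tendsto ε atTop (𝓝 0) := tendsto_one_div_add_atTop_nhds_zero_nat
  choose G h1 h2 using fun n => exists_inverse_add_smul hB (hε n)
  have hG : ∀ n y, 0 ≤ ⟪G n y, y⟫ := fun n => inner_inverse_nonneg hB (hε n) (h1 n)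
  let K : ℕ → H →L[ℝ] (ℝ →ᵇ H) := fun n => orbitMap (G n) (hG n) T
  have hK : ∀ n y, ‖K n y‖ ≤ 1 * ‖y‖ := fun n y => by
    rw [one_mul]; exact norm_orbitMap_le (hG n) y
  -- Two factors of `B` are needed: the resolvent identity produces `G n ∘ G m`, and each factor is
  -- bounded uniformly only after `B`.
  have hBB : DenseRange (B ∘ B) := hBd.comp hBd B.continuous
  have hKc : ∀ y, CauchySeq fun n => K n y := by
    refine cauchySeq_apply_of_denseRange hK hBB fun g => ?_
    have hb : ∀ n m, dist (K n (B (B g))) (K m (B (B g))) ≤ T * (4 * ‖g‖) * dist (ε n) (ε m) := by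
      intro n m
      rw [dist_eq_norm]
      refine (norm_orbitMap_sub_le (hG n) (hG m)
        (commute_inverse (h1 n) (h2 n) (h1 m) (h2 m)) hT _).trans ?_
      rw [inverse_sub_apply (h2 n) (h1 m), norm_smul, inverse_apply_comm (h1 m) (h2 m),
        dist_comm, dist_eq_norm]
      have e1 := norm_inverse_apply_le hB (hε n) (h1 n) (h2 n) (G m (B g))
      have e2 := norm_inverse_apply_le hB (hε m) (h1 m) (h2 m) g
      calc T * (‖ε m - ε n‖ * ‖G n (B (G m (B g)))‖)
          ≤ T * (‖ε m - ε n‖ * (4 * ‖g‖)) := by gcongr; linarith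
        _ = T * (4 * ‖g‖) * ‖ε m - ε n‖ := by ring
    have hεc := (hε0.const_mul (T * (4 * ‖g‖))).cauchySeq
    rw [Metric.cauchySeq_iff'] at hεc ⊢
    intro δ hδ
    obtain ⟨N, hN⟩ := hεc δ hδ
    refine ⟨N, fun n hn => (hb n N).trans_lt ?_⟩
    have h := hN n hn
    rwa [Real.dist_eq, ← mul_sub, abs_mul, abs_of_nonneg (by positivity), ← Real.dist_eq] at h
  -- On the range of `B` this is `ε` times the bounded quantity `G B g`; density and `‖ε G‖ ≤ 1`
  -- give the rest.
  have hεG : ∀ y, Tendsto (fun n => (ε n • G n) y) atTop (𝓝 0) := by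
    refine tendsto_zero_apply_of_denseRange (C := 1)
      (fun n y => by simpa using norm_smul_inverse_le hB (hε n) (h1 n) y) hBd fun g => ?_
    refine squeeze_zero_norm (a := fun n => ε n * (2 * ‖g‖)) (fun n => ?_) ?_
    · rw [smul_apply, norm_smul, Real.norm_of_nonneg (hε n).le]
      exact mul_le_mul_of_nonneg_left (norm_inverse_apply_le hB (hε n) (h1 n) (h2 n) g) (hε n).le
    · simpa using hε0.mul_const (2 * ‖g‖)
  have hKε : ∀ y, Tendsto (fun n => K n ((ε n • G n) y)) atTop (𝓝 0) := fun y =>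
    squeeze_zero_norm (fun n => by simpa using hK n ((ε n • G n) y)) (by simpa using (hεG y).norm)
  let J : (ℝ →ᵇ H) →L[ℝ] Lp V 2 (volume.restrict (timeInterval T : Set ℝ)) :=
    (BoundedContinuousFunction.toLp 2 (volume.restrict (timeInterval T : Set ℝ)) ℝ).comp
      (R.compLeftContinuousBounded ℝ)
  let M : ℕ → H →L[ℝ] Lp V 2 (volume.restrict (timeInterval T : Set ℝ)) := fun n =>
    (BoundedContinuousFunction.toLp 2 (volume.restrict (timeInterval T : Set ℝ)) ℝ).comp
      (((R.comp (G n)).compLeftContinuousBounded ℝ).comp (K n))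
  -- On the range of `B` the unbounded factor disappears, as `G n (B g) = g - ε n • G n g`;
  -- convergence in `L²(0,T;V)` then follows from uniform convergence in `H`.
  have hMK : ∀ n g, M n (B g) = J (K n g) - J (K n ((ε n • G n) g)) := fun n g => by
    rw [← map_sub, ← map_sub]
    refine congrArg (BoundedContinuousFunction.toLp 2 _ ℝ)
      (BoundedContinuousFunction.ext fun t => congrArg R ?_)
    rw [show g - (ε n • G n) g = G n (B g) from sub_eq_of_eq_add (h2 n g).symm]
    exact map_orbitMap (hG n) (B g) t
  have hMc : ∀ y, CauchySeq fun n => M n y := by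
    refine cauchySeq_apply_of_denseRange
      (fun n y => norm_toLp_orbitMap_le hT hα ha hR (hε n) (h1 n) (hG n) y) hBd fun g => ?_
    obtain ⟨k, hk⟩ := cauchySeq_tendsto_of_complete (hKc g)
    simp_rw [hMK]
    exact (((J.continuous.tendsto k).comp hk).sub
      ((J.continuous.tendsto 0).comp (hKε g))).cauchySeq
  obtain ⟨c, hc⟩ := cauchySeq_tendsto_of_complete (hKc x)
  obtain ⟨u, hu⟩ := cauchySeq_tendsto_of_complete (hMc x)
  have hcL := ((BoundedContinuousFunction.toLp 2 (volume.restrict (timeInterval T : Set ℝ))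
    ℝ).continuous.tendsto c).comp hc
  refine ⟨c, u, ?_, ?_, fun φ hφ hφ0 hφT v => ?_⟩
  · have h : Tendsto (fun n => K n x 0) atTop (𝓝 (c 0)) :=
      (BoundedContinuousFunction.tendsto_iff_tendstoUniformly.1 hc).tendsto_at 0
    refine tendsto_nhds_unique h (tendsto_const_nhds.congr fun n => ?_)
    rw [orbitMap_apply_of_mem (hG n) (left_mem_Icc.2 hT)]
    simp
  -- Limit of the identity `i R G = 1 - ε G` applied along the orbits.
  · have hlim : i.compLpL 2 _ u =
        BoundedContinuousFunction.toLp 2 (volume.restrict (timeInterval T : Set ℝ)) ℝ c := by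
      refine tendsto_nhds_unique (((i.compLpL 2 _).continuous.tendsto u).comp hu) ?_
      have h := hcL.sub (((BoundedContinuousFunction.toLp 2
        (volume.restrict (timeInterval T : Set ℝ)) ℝ).continuous.tendsto 0).comp (hKε x))
      rw [map_zero, sub_zero] at h
      refine h.congr fun n => ?_
      simp only [Function.comp_apply]
      rw [← map_sub, ← map_sub]
      refine Lp.ext ?_
      refine (BoundedContinuousFunction.coeFn_toLp _ _ ℝ _).trans ?_
      filter_upwards [ContinuousLinearMap.coeFn_compLp i (M n x),
        BoundedContinuousFunction.coeFn_toLp 2 (volume.restrict (timeInterval T : Set ℝ)) ℝ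
          ((R.comp (G n)).compLeftContinuousBounded ℝ (K n x))] with t ht ht'
      refine Eq.trans ?_ ht.symm
      refine Eq.trans ?_ (congrArg i ht').symm
      change K n (x - ε n • G n x) t = B (G n (K n x t))
      rw [map_sub, map_smul]
      change K n x t - ε n • orbitMap (G n) (hG n) T (G n x) t = B (G n (K n x t))
      rw [← map_orbitMap (hG n)]
      exact sub_eq_of_eq_add (h1 n (K n x t)).symm
    have h1' := ContinuousLinearMap.coeFn_compLp i u
    have h2' := BoundedContinuousFunction.coeFn_toLp 2
      (volume.restrict (timeInterval T : Set ℝ)) ℝ c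
    rw [← hlim] at h2'
    exact h2'.symm.trans h1'
  · have hl := tendsto_integral_mul_dual (hφ.continuous_deriv le_rfl) (innerSL ℝ (i v)) hcL
    have hr := tendsto_integral_mul_dual hφ.continuous (a.flip v) hu
    have e := BoundedContinuousFunction.coeFn_toLp 2
      (volume.restrict (timeInterval T : Set ℝ)) ℝ c
    have el : ∫ t in (timeInterval T : Set ℝ), deriv φ t * ⟪i v, c t⟫ =
        ∫ t in (timeInterval T : Set ℝ), deriv φ t * innerSL ℝ (i v)
          (BoundedContinuousFunction.toLp 2 (volume.restrict (timeInterval T : Set ℝ)) ℝ c t) := by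
      refine integral_congr_ae (e.mono fun t ht => ?_)
      simp only [ht]; rfl
    rw [el]
    refine tendsto_nhds_unique hl (hr.congr fun n => ?_)
    have en := BoundedContinuousFunction.coeFn_toLp 2
      (volume.restrict (timeInterval T : Set ℝ)) ℝ (K n x)
    have en' := BoundedContinuousFunction.coeFn_toLp 2
      (volume.restrict (timeInterval T : Set ℝ)) ℝ
      ((R.comp (G n)).compLeftContinuousBounded ℝ (K n x))
    refine Eq.trans ?_ ((integral_deriv_mul_orbitMap hT hR (hG n) x hφ hφ0 hφT v).symm.trans ?_)
    · refine integral_congr_ae (en'.mono fun t ht => ?_)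
      exact congrArg (fun w => φ t * a w v) ht
    · refine integral_congr_ae (en.mono fun t ht => ?_)
      exact congrArg (fun w => deriv φ t * ⟪i v, w⟫) ht.symm

end Existence

/-! ### From coercive forms to forms with a Gårding inequality. -/

section Garding

open Filter
open scoped Topology RealInnerProductSpace BoundedContinuousFunction

theorem integrable_mul_dual_timeInterval {X : Type*} [NormedAddCommGroup X] [NormedSpace ℝ X]
    {T : ℝ} {ψ : ℝ → ℝ} (hψ : Continuous ψ) (l : StrongDual ℝ X)
    (f : Lp X 2 (volume.restrict (timeInterval T : Set ℝ))) :
    Integrable (fun t => ψ t * l (f t)) (volume.restrict (timeInterval T : Set ℝ)) := by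
  obtain ⟨C, hC⟩ := exists_bound_timeInterval hψ T
  exact (l.integrable_comp ((Lp.memLp f).integrable one_le_two)).bdd_mul hψ.aestronglyMeasurable hC

variable {V H : Type*} [NormedAddCommGroup V] [InnerProductSpace ℝ V] [CompleteSpace V]
  [NormedAddCommGroup H] [InnerProductSpace ℝ H] [CompleteSpace H]

/-- Existence of a weak solution under a Gårding inequality. -/
theorem exists_weak_solution {i : V →L[ℝ] H} (hi : DenseRange i)
    {a : V →L[ℝ] V →L[ℝ] ℝ} {α r T : ℝ} (hα : 0 < α)
    (ha : ∀ v, α * ‖v‖ ^ 2 ≤ a v v + r * ‖i v‖ ^ 2) (hT : 0 ≤ T) (x : H) :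
    ∃ (c : ℝ → H) (u : Lp V 2 (volume.restrict (timeInterval T : Set ℝ))), Continuous c ∧ c 0 = x ∧
      (∀ᵐ t ∂(volume.restrict (timeInterval T : Set ℝ)), c t = i (u t)) ∧
      ∀ φ : ℝ → ℝ, ContDiff ℝ 1 φ → φ 0 = 0 → φ T = 0 → ∀ v,
        ∫ t in (timeInterval T : Set ℝ), deriv φ t * ⟪i v, c t⟫ =
          ∫ t in (timeInterval T : Set ℝ), φ t * a (u t) v := by
  let m : H →L[ℝ] H →L[ℝ] ℝ := innerSL ℝ
  let b : V →L[ℝ] V →L[ℝ] ℝ := a + r • m.bilinearComp i i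
  have hb : ∀ v w, b v w = a v w + r * ⟪i v, i w⟫ := fun v w => rfl
  obtain ⟨c, u, hc0, hcu, hw⟩ := exists_weak_solution_of_coercive hi (a := b) hα
    (fun v => by rw [hb, real_inner_self_eq_norm_sq]; exact ha v) hT x
  have hE : Continuous fun t : ℝ => Real.exp (r * t) := by fun_prop
  obtain ⟨C, hC⟩ := exists_bound_timeInterval hE T
  have hm : MemLp (fun t => Real.exp (r * t) • u t) 2
      (volume.restrict (timeInterval T : Set ℝ)) :=
    (Lp.memLp u).of_le_mul (hE.aestronglyMeasurable.smul (Lp.aestronglyMeasurable u))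
      (hC.mono fun t ht => by rw [norm_smul]; gcongr)
  -- If `u` solves the problem for `b = a + r ⟪i ·, i ·⟫`, then `exp (r t) u` solves it for `a`. In
  -- the weak form the exponential moves to the test function.
  refine ⟨fun t => Real.exp (r * t) • c t, hm.toLp, hE.smul c.continuous, by simp [hc0], ?_,
    fun φ hφ hφ0 hφT v => ?_⟩
  · filter_upwards [hm.coeFn_toLp, hcu] with t ht ht'
    rw [ht, ht', map_smul]
  · have hφd : ∀ t, HasDerivAt (fun t => Real.exp (r * t) * φ t)
        (Real.exp (r * t) * deriv φ t + r * (Real.exp (r * t) * φ t)) t := fun t => by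
      have h1 : HasDerivAt (fun t : ℝ => Real.exp (r * t)) (Real.exp (r * t) * r) t := by
        simpa using ((hasDerivAt_id t).const_mul r).exp
      exact (h1.mul (hφ.differentiable (by simp) t).hasDerivAt).congr_deriv (by ring)
    have key := hw (fun t => Real.exp (r * t) * φ t) (by fun_prop) (by simp [hφ0]) (by simp [hφT]) v
    have hφc := hφ.continuous
    have hφc' := hφ.continuous_deriv le_rfl
    have hl : ∀ ψ : ℝ → ℝ, Continuous ψ →
        Integrable (fun t => ψ t * ⟪i v, i (u t)⟫) (volume.restrict (timeInterval T : Set ℝ)) :=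
      fun ψ hψ => integrable_mul_dual_timeInterval hψ ((innerSL ℝ (i v)).comp i) u
    have i1 := hl _ (hE.mul hφc')
    have i2 := hl _ ((hE.mul hφc).const_mul r)
    have i3 := integrable_mul_dual_timeInterval (hE.mul hφc) (a.flip v) u
    have e1 : ∫ t in (timeInterval T : Set ℝ),
        deriv (fun t => Real.exp (r * t) * φ t) t * ⟪i v, c t⟫ =
        (∫ t in (timeInterval T : Set ℝ), Real.exp (r * t) * deriv φ t * ⟪i v, i (u t)⟫) +
        ∫ t in (timeInterval T : Set ℝ), r * (Real.exp (r * t) * φ t) * ⟪i v, i (u t)⟫ := by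
      refine Eq.trans ?_ (integral_add i1 i2)
      refine integral_congr_ae (hcu.mono fun t ht => ?_)
      simp only [(hφd t).deriv, ht]
      ring
    have e2 : ∫ t in (timeInterval T : Set ℝ), Real.exp (r * t) * φ t * b (u t) v =
        (∫ t in (timeInterval T : Set ℝ), Real.exp (r * t) * φ t * a (u t) v) +
        ∫ t in (timeInterval T : Set ℝ), r * (Real.exp (r * t) * φ t) * ⟪i v, i (u t)⟫ := by
      refine Eq.trans ?_ (integral_add i3 i2)
      refine integral_congr_ae (.of_forall fun t => ?_)
      simp only [hb, real_inner_comm (i v)]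
      ring
    rw [e1, e2, add_left_inj] at key
    refine Eq.trans ?_ (key.trans ?_)
    · refine integral_congr_ae (hcu.mono fun t ht => ?_)
      simp only [ht, real_inner_smul_right]
      ring
    · refine integral_congr_ae (hm.coeFn_toLp.mono fun t ht => ?_)
      simp only [ht, map_smul, smul_apply, smul_eq_mul]
      ring

end Garding

/-! ### Scalar functions with a prescribed weak derivative. -/

section DuBoisReymond

open Filter
open scoped Topology RealInnerProductSpace ContDiff

variable {T : ℝ}

/-- A smooth function with compact support in `(0,T)` and vanishing integral has a primitive with
compact support in `(0,T)`. -/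
theorem exists_testFunction_deriv_eq {ψ : ℝ → ℝ} (hψ : ContDiff ℝ ∞ ψ) (hc : HasCompactSupport ψ)
    (hs : tsupport ψ ⊆ Ioo 0 T) (h0 : ∫ t in (0 : ℝ)..T, ψ t = 0) :
    ∃ φ : 𝓓(timeInterval T, ℝ), deriv φ = ψ := by
  obtain ⟨a, b, ha, hb, hab⟩ : ∃ a b : ℝ, 0 < a ∧ b < T ∧ tsupport ψ ⊆ Icc a b := by
    rcases (tsupport ψ).eq_empty_or_nonempty with he | hne
    · exact ⟨1, T - 1, one_pos, by linarith, by simp [he]⟩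
    · obtain ⟨a, ha, ha'⟩ := hc.isCompact.exists_isLeast hne
      obtain ⟨b, hb, hb'⟩ := hc.isCompact.exists_isGreatest hne
      exact ⟨a, b, (hs ha).1, (hs hb).2, fun t ht => ⟨ha' ht, hb' ht⟩⟩
  have hz : ∀ t, t ∉ Icc a b → ψ t = 0 := fun t ht => image_eq_zero_of_notMem_tsupport (mt (@hab t) ht)
  have hd : ∀ t, HasDerivAt (fun t => ∫ s in (0 : ℝ)..t, ψ s) (ψ t) t := fun t =>
    (hψ.continuous.integral_hasStrictDerivAt 0 t).hasDerivAt
  have hderiv : deriv (fun t => ∫ s in (0 : ℝ)..t, ψ s) = ψ := funext fun t => (hd t).deriv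
  -- The primitive vanishes left of `a` because `ψ` does, and right of `b` because the total
  -- integral of `ψ` is zero.
  have hsub : tsupport (fun t => ∫ s in (0 : ℝ)..t, ψ s) ⊆ Icc a b := by
    refine closure_minimal (fun t ht => ?_) isClosed_Icc
    by_contra hn
    refine ht ?_
    rw [mem_Icc, not_and_or, not_le, not_le] at hn
    rcases hn with h | h
    · refine intervalIntegral.integral_zero_ae (.of_forall fun s hs' => hz s fun hm => ?_)
      rcases mem_uIoc.1 hs' with h' | h' <;> linarith [h'.2, hm.1]
    · have e : ∫ s in T..t, ψ s = 0 := by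
        refine intervalIntegral.integral_zero_ae (.of_forall fun s hs' => hz s fun hm => ?_)
        rcases mem_uIoc.1 hs' with h' | h' <;> linarith [h'.1, hm.2]
      change ∫ s in (0 : ℝ)..t, ψ s = 0
      rw [← intervalIntegral.integral_add_adjacent_intervals
        (hψ.continuous.intervalIntegrable 0 T) (hψ.continuous.intervalIntegrable T t), h0, e,
        add_zero]
  refine ⟨⟨fun t => ∫ s in (0 : ℝ)..t, ψ s, ?_, ?_, ?_⟩, hderiv⟩
  · exact contDiff_infty_iff_deriv.2 ⟨fun t => (hd t).differentiableAt, by rwa [hderiv]⟩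
  · exact isCompact_Icc.of_isClosed_subset (isClosed_tsupport _) hsub
  · exact hsub.trans fun t ht => ⟨ha.trans_le ht.1, ht.2.trans_lt hb⟩

/-- A continuous function with vanishing weak derivative is constant. -/
theorem eq_of_forall_integral_deriv_mul_eq_zero (hT : 0 < T) {F : ℝ → ℝ}
    (hF : ContinuousOn F (Icc 0 T))
    (h : ∀ φ : 𝓓(timeInterval T, ℝ), ∫ t in (0 : ℝ)..T, deriv φ t * F t = 0) {t : ℝ}
    (ht : t ∈ Icc 0 T) : F t = F 0 := by
  obtain ⟨χ, hχs, hχc, hχ, hχr, hχ1⟩ := exists_contDiff_tsupport_subset (n := ⊤)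
    (Ioo_mem_nhds (half_pos hT) (half_lt_self hT))
  have hI : 0 < ∫ t in (0 : ℝ)..T, χ t :=
    intervalIntegral.integral_pos hT hχ.continuous.continuousOn
      (fun t _ => (hχr ⟨t, rfl⟩).1) ⟨T / 2, ⟨(half_pos hT).le, (half_lt_self hT).le⟩, by simp [hχ1]⟩
  set I := ∫ t in (0 : ℝ)..T, χ t
  have hint : ∀ ψ : ℝ → ℝ, Continuous ψ →
      IntervalIntegrable (fun t => ψ t * F t) volume 0 T := fun ψ hψ =>
    (hψ.continuousOn.mul (by rwa [uIcc_of_le hT.le])).intervalIntegrable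
  -- If `F` is constant, this weighted mean is its value.
  set C := (∫ t in (0 : ℝ)..T, χ t * F t) / I
  have key : ∀ ψ : ℝ → ℝ, ContDiff ℝ ∞ ψ → HasCompactSupport ψ → tsupport ψ ⊆ Ioo 0 T →
      ∫ t, ψ t • (F t - C) = 0 := by
    intro ψ hψ hψc hψs
    set J := ∫ t in (0 : ℝ)..T, ψ t
    have hsup : tsupport (fun t => ψ t - J / I * χ t) ⊆ tsupport ψ ∪ tsupport χ := by
      refine (tsupport_sub ψ fun t => J / I * χ t).trans (union_subset_union_right _ ?_)
      exact closure_mono (Function.support_mul_subset_right _ _)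
    -- Subtracting the multiple `J / I` of `χ` makes the integral zero, so the result is the
    -- derivative of a test function.
    obtain ⟨φ, hφ⟩ := exists_testFunction_deriv_eq (T := T) (ψ := fun t => ψ t - J / I * χ t)
      (hψ.sub (contDiff_const.mul hχ))
      ((hψc.isCompact.union hχc.isCompact).of_isClosed_subset (isClosed_tsupport _) hsup)
      (hsup.trans (union_subset hψs hχs)) (by
        rw [intervalIntegral.integral_sub (hψ.continuous.intervalIntegrable _ _)
          ((hχ.continuous.const_mul _).intervalIntegrable _ _),
          intervalIntegral.integral_const_mul]
        change J - J / I * I = 0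
        rw [div_mul_cancel₀ _ hI.ne', sub_self])
    have h1 := h φ
    rw [hφ] at h1
    have e : ∫ t in (0 : ℝ)..T, (ψ t - J / I * χ t) * F t =
        (∫ t in (0 : ℝ)..T, ψ t * F t) - J / I * ∫ t in (0 : ℝ)..T, χ t * F t := by
      rw [← intervalIntegral.integral_const_mul, ← intervalIntegral.integral_sub
        (hint ψ hψ.continuous) ((hint χ hχ.continuous).const_mul _)]
      exact intervalIntegral.integral_congr fun t _ => by ring
    rw [e] at h1
    have e2 : ∫ t, ψ t • (F t - C) = ∫ t in (0 : ℝ)..T, ψ t * (F t - C) := by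
      rw [← integral_timeInterval hT.le, setIntegral_eq_integral_of_forall_compl_eq_zero]
      · rfl
      · intro t ht
        rw [image_eq_zero_of_notMem_tsupport (mt (@hψs t) ht), zero_mul]
    rw [e2]
    simp_rw [mul_sub]
    rw [intervalIntegral.integral_sub (hint ψ hψ.continuous)
      ((hψ.continuous.mul_const C).intervalIntegrable _ _), intervalIntegral.integral_mul_const]
    change _ - J * C = 0
    refine Eq.trans ?_ h1
    rw [div_mul_eq_mul_div, ← mul_div_assoc]
  have hloc : LocallyIntegrableOn (fun t => F t - C) (Ioo 0 T) :=
    ((hF.sub continuousOn_const).mono Ioo_subset_Icc_self).locallyIntegrableOn measurableSet_Ioo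
  have hae := isOpen_Ioo.ae_eq_zero_of_integral_contDiff_smul_eq_zero hloc key
  have heq : EqOn F (fun _ => C) (Icc 0 T) := by
    refine Measure.eqOn_Icc_of_ae_eq volume hT.ne ?_ hF continuousOn_const
    rw [← restrict_Ioo_eq_restrict_Icc]
    refine (ae_restrict_iff' measurableSet_Ioo).2 (hae.mono fun t ht hm => ?_)
    exact sub_eq_zero.1 (ht hm)
  rw [heq ht, heq (left_mem_Icc.2 hT.le)]

/-- A continuous function with integrable weak derivative `g` is a primitive of `g`. -/
theorem eq_add_integral_of_weak_deriv (hT : 0 < T) {f g : ℝ → ℝ} (hf : Continuous f)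
    (hg : IntervalIntegrable g volume 0 T)
    (h : ∀ φ : 𝓓(timeInterval T, ℝ), ∫ t in (0 : ℝ)..T, deriv φ t * f t =
      -∫ t in (0 : ℝ)..T, φ t * g t) {t : ℝ} (ht : t ∈ Icc 0 T) :
    f t = f 0 + ∫ s in (0 : ℝ)..t, g s := by
  -- As `g` is only integrable, its primitive is merely absolutely continuous; integration by parts
  -- in that class shows that `f` minus the primitive has weak derivative zero.
  have hac := hg.absolutelyContinuousOnInterval_intervalIntegral left_mem_uIcc
  have hcont := hac.continuousOn
  rw [uIcc_of_le hT.le] at hcont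
  have key := eq_of_forall_integral_deriv_mul_eq_zero hT (F := fun t => f t - ∫ s in (0 : ℝ)..t, g s)
    (hf.continuousOn.sub hcont) (fun φ => ?_) ht
  · simp only [intervalIntegral.integral_same, sub_zero] at key
    linarith
  · have hφ1 : ContDiff ℝ 1 φ := φ.contDiff.of_le (by exact_mod_cast le_top)
    have hφT : φ T = 0 := image_eq_zero_of_notMem_tsupport fun hm =>
      lt_irrefl _ (φ.tsupport_subset hm).2
    have hφ0 : φ 0 = 0 := image_eq_zero_of_notMem_tsupport fun hm =>
      lt_irrefl _ (φ.tsupport_subset hm).1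
    have hφ' := hφ1.continuous_deriv le_rfl
    have hparts := hac.integral_mul_deriv_eq_deriv_mul
      (hφ1.contDiffOn.absolutelyContinuousOnInterval (a := 0) (b := T))
    rw [hφT, hφ0, mul_zero, mul_zero, sub_zero, zero_sub] at hparts
    have hder : ∫ x in (0 : ℝ)..T, deriv (fun x => ∫ s in (0 : ℝ)..x, g s) x * φ x =
        ∫ t in (0 : ℝ)..T, φ t * g t := by
      refine intervalIntegral.integral_congr_ae ?_
      filter_upwards [hg.ae_hasDerivAt_integral] with x hx hm
      rw [(hx (uIoc_subset_uIcc hm) 0 left_mem_uIcc).deriv, mul_comm]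
    rw [hder] at hparts
    have i1 : IntervalIntegrable (fun t => deriv φ t * f t) volume 0 T :=
      (hφ'.mul hf).intervalIntegrable _ _
    have i2 : IntervalIntegrable (fun t => deriv φ t * ∫ s in (0 : ℝ)..t, g s) volume 0 T :=
      (hφ'.continuousOn.mul hac.continuousOn).intervalIntegrable
    simp_rw [mul_sub]
    rw [intervalIntegral.integral_sub i1 i2, h φ, ← hparts, sub_eq_zero]
    exact intervalIntegral.integral_congr fun x _ => mul_comm _ _

end DuBoisReymond

/-! ### Uniqueness through the time-integrated equation. -/

section Uniqueness

open Filter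
open scoped Topology RealInnerProductSpace

variable {V H : Type*} [NormedAddCommGroup V] [InnerProductSpace ℝ V] [CompleteSpace V]
  [NormedAddCommGroup H] [InnerProductSpace ℝ H] [CompleteSpace H]

/-- A weak solution with vanishing initial value vanishes. -/
theorem weak_solution_eq_zero {i : V →L[ℝ] H} (hi : Function.Injective i)
    {a : V →L[ℝ] V →L[ℝ] ℝ} {r T : ℝ} (ha : ∀ v, 0 ≤ a v v + r * ‖i v‖ ^ 2) (hT : 0 < T)
    {c : ℝ → H} (hc : Continuous c) (hc0 : c 0 = 0)
    {u : Lp V 2 (volume.restrict (timeInterval T : Set ℝ))}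
    (hcu : ∀ᵐ t ∂(volume.restrict (timeInterval T : Set ℝ)), c t = i (u t))
    (hw : ∀ (φ : 𝓓(timeInterval T, ℝ)) (v : V),
      ∫ t in (timeInterval T : Set ℝ), deriv φ t * ⟪i v, c t⟫ =
        ∫ t in (timeInterval T : Set ℝ), φ t * a (u t) v) :
    u = 0 := by
  have hu : IntervalIntegrable u volume 0 T := by
    rw [intervalIntegrable_iff_integrableOn_Ioo_of_le hT.le]
    exact (Lp.memLp u).integrable one_le_two
  have hut : ∀ t ∈ Icc 0 T, IntervalIntegrable u volume 0 t := fun t ht =>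
    hu.mono_set (uIcc_subset_uIcc left_mem_uIcc (by rwa [uIcc_of_le hT.le]))
  -- For fixed `v` the equation is scalar. Integrated in time, it can be tested with the `V`-valued
  -- primitive of `u`.
  have h1 : ∀ t ∈ Icc 0 T, ∀ v, ⟪i v, c t⟫ = -a (∫ s in (0 : ℝ)..t, u s) v := by
    intro t ht v
    have hg : IntervalIntegrable (fun s => -a (u s) v) volume 0 T :=
      ⟨((a.flip v).integrable_comp hu.1).neg, ((a.flip v).integrable_comp hu.2).neg⟩
    have h := eq_add_integral_of_weak_deriv hT (f := fun t => ⟪i v, c t⟫) (by fun_prop) hg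
      (fun φ => by
        rw [← integral_timeInterval hT.le, ← integral_timeInterval hT.le, hw, ← integral_neg]
        simp) ht
    simp only [hc0, inner_zero_right, zero_add] at h
    rw [h, intervalIntegral.integral_neg]
    exact congrArg Neg.neg ((a.flip v).intervalIntegral_comp_comm (hut t ht))
  have hd : ∀ t, HasDerivAt (fun t => ∫ s in (0 : ℝ)..t, c s) (c t) t := fun t =>
    (hc.integral_hasStrictDerivAt 0 t).hasDerivAt
  have h2 : ∀ t ∈ Icc 0 T, i (∫ s in (0 : ℝ)..t, u s) = ∫ s in (0 : ℝ)..t, c s := by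
    intro t ht
    rw [← i.intervalIntegral_comp_comm (hut t ht)]
    refine intervalIntegral.integral_congr_ae_restrict ?_
    rw [uIoc_of_le ht.1, ← restrict_Ioo_eq_restrict_Ioc]
    refine (ae_restrict_of_ae_restrict_of_subset (Ioo_subset_Ioo_right ht.2) hcu).mono
      fun s hs => hs.symm
  have hE : ∀ t, HasDerivAt (fun t => Real.exp (-(2 * r) * t) * ‖∫ s in (0 : ℝ)..t, c s‖ ^ 2)
      (Real.exp (-(2 * r) * t) *
        (2 * (⟪∫ s in (0 : ℝ)..t, c s, c t⟫ - r * ‖∫ s in (0 : ℝ)..t, c s‖ ^ 2))) t := fun t => by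
    have he : HasDerivAt (fun t : ℝ => Real.exp (-(2 * r) * t))
        (Real.exp (-(2 * r) * t) * (-(2 * r))) t := by
      simpa using ((hasDerivAt_id t).const_mul (-(2 * r))).exp
    exact (he.mul (hd t).norm_sq).congr_deriv (by ring)
  -- Gronwall: with `v` the primitive of `u`, the bracket in `hE` becomes `-(a v v + r * ‖i v‖ ^ 2)
  -- ≤ 0`.
  have hanti : AntitoneOn (fun t => Real.exp (-(2 * r) * t) * ‖∫ s in (0 : ℝ)..t, c s‖ ^ 2)
      (Icc 0 T) := by
    refine antitoneOn_of_deriv_nonpos (convex_Icc 0 T)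
      (fun t _ => (hE t).continuousAt.continuousWithinAt)
      (fun t _ => (hE t).differentiableAt.differentiableWithinAt) fun t ht => ?_
    rw [interior_Icc] at ht
    have ht' := Ioo_subset_Icc_self ht
    rw [(hE t).deriv, ← h2 t ht', h1 t ht']
    refine mul_nonpos_of_nonneg_of_nonpos (Real.exp_pos _).le ?_
    linarith [ha (∫ s in (0 : ℝ)..t, u s)]
  have hzero : ∀ t ∈ Icc 0 T, ∫ s in (0 : ℝ)..t, c s = 0 := fun t ht => by
    have h := hanti (left_mem_Icc.2 hT.le) ht ht.1
    simp only [intervalIntegral.integral_same, norm_zero] at h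
    have hpos := Real.exp_pos (-(2 * r) * t)
    have h3 : ‖∫ s in (0 : ℝ)..t, c s‖ ^ 2 ≤ 0 := by
      refine nonpos_of_mul_nonpos_right (h.trans (by simp)) hpos
    exact norm_eq_zero.1 (pow_eq_zero_iff two_ne_zero |>.1 (le_antisymm h3 (sq_nonneg _)))
  have hc' : ∀ t ∈ Ioo 0 T, c t = 0 := fun t ht => by
    have hev : (fun t => ∫ s in (0 : ℝ)..t, c s) =ᶠ[𝓝 t] fun _ => 0 :=
      mem_of_superset (Ioo_mem_nhds ht.1 ht.2) fun s hs => hzero s (Ioo_subset_Icc_self hs)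
    exact (hd t).unique ((hasDerivAt_const t 0).congr_of_eventuallyEq hev)
  refine Lp.ext ?_
  filter_upwards [hcu, ae_mem_timeInterval T,
    Lp.coeFn_zero V 2 (volume.restrict (timeInterval T : Set ℝ))] with t ht htm h0
  rw [h0]
  exact hi (by rw [← ht, hc' t htm, Pi.zero_apply, map_zero])

end Uniqueness

/-! ### Completeness of the Sobolev spaces and the dense injection into `L²(Ω)`. -/

section SobolevSpaces

open scoped RealInnerProductSpace ContDiff

variable {d : ℕ} {Ω : Opens (EucSp d)}

theorem L2.integral_mul_eq_inner {f : EucSp d → ℝ}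
    (hf : MemLp f 2 (volume.restrict (Ω : Set (EucSp d)))) (u : L2 Ω) :
    ∫ x in (Ω : Set (EucSp d)), u x * f x = ⟪hf.toLp, u⟫ := by
  rw [L2.inner_def]
  refine integral_congr_ae ?_
  filter_upwards [hf.coeFn_toLp] with x hx
  rw [hx]
  rfl

theorem L2.continuous_integral_mul {f : EucSp d → ℝ} (hf : Continuous f)
    (hc : HasCompactSupport f) :
    Continuous fun u : L2 Ω => ∫ x in (Ω : Set (EucSp d)), u x * f x := by
  have h : MemLp f 2 (volume.restrict (Ω : Set (EucSp d))) := hf.memLp_of_hasCompactSupport hc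
  simp_rw [L2.integral_mul_eq_inner h]
  fun_prop

theorem L2.eq_zero_of_forall_integral_mul_test {u : L2 Ω}
    (h : ∀ φ : 𝓓(Ω, ℝ), ∫ x in (Ω : Set (EucSp d)), u x * φ x = 0) : u = 0 := by
  have hloc : LocallyIntegrableOn u (Ω : Set (EucSp d)) volume :=
    locallyIntegrableOn_of_locallyIntegrable_restrict
      ((Lp.memLp u).locallyIntegrable (by norm_num))
  have hae := Ω.isOpen.ae_eq_zero_of_integral_contDiff_smul_eq_zero hloc fun g hg hgc hgs => by
    rw [← h ⟨g, hg, hgc, hgs⟩, setIntegral_eq_integral_of_forall_compl_eq_zero]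
    · exact integral_congr_ae (.of_forall fun x => mul_comm _ _)
    · intro x hx
      change u x * g x = 0
      rw [image_eq_zero_of_notMem_tsupport (mt (@hgs x) hx), mul_zero]
  refine Lp.ext (Filter.EventuallyEq.trans ?_ (Lp.coeFn_zero ℝ 2 _).symm)
  exact (ae_restrict_iff' Ω.isOpen.measurableSet).2 hae

/-- For each test function both sides of the defining identity are continuous in the `L²` norm. -/
theorem isClosed_weakGradientGraph (Ω : Opens (EucSp d)) :
    IsClosed (weakGradientGraph Ω : Set (WithLp 2 (L2 Ω × PiLp 2 (fun _ : Fin d => L2 Ω)))) := by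
  have h : (weakGradientGraph Ω : Set (WithLp 2 (L2 Ω × PiLp 2 (fun _ : Fin d => L2 Ω)))) =
      ⋂ (i : Fin d) (φ : 𝓓(Ω, ℝ)), {p | ∫ x in (Ω : Set (EucSp d)),
        p.fst x * fderiv ℝ φ x (EuclideanSpace.single i 1) =
          -∫ x in (Ω : Set (EucSp d)), p.snd i x * φ x} := by
    ext p
    simp only [mem_iInter]
    rfl
  rw [h]
  refine isClosed_iInter fun i => isClosed_iInter fun φ => isClosed_eq ?_ ?_
  · exact (L2.continuous_integral_mul
      ((φ.contDiff.continuous_fderiv (by simp)).clm_apply continuous_const)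
      (φ.hasCompactSupport.fderiv_apply ℝ _)).comp (WithLp.continuous_fst 2 _ _)
  · exact ((L2.continuous_integral_mul φ.continuous φ.hasCompactSupport).comp
      ((PiLp.continuous_apply 2 _ i).comp (WithLp.continuous_snd 2 _ _))).neg

instance H1.instCompleteSpace (Ω : Opens (EucSp d)) : CompleteSpace (H1 Ω) :=
  (isClosed_weakGradientGraph Ω).completeSpace_coe

instance H10.instCompleteSpace (Ω : Opens (EucSp d)) : CompleteSpace (H10 Ω) :=
  (testSubspace Ω).isClosed_topologicalClosure.completeSpace_coe

theorem H1.norm_sq (u : H1 Ω) :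
    ‖u‖ ^ 2 = ‖H1.toL2 Ω u‖ ^ 2 + ∑ i, ‖H1.weakPartial Ω i u‖ ^ 2 := by
  have h := WithLp.prod_norm_sq_eq_of_L2 (u : weakGradientGraph Ω).1
  rw [PiLp.norm_sq_eq_of_L2] at h
  exact h

theorem H10.norm_sq (u : H10 Ω) :
    ‖u‖ ^ 2 = ‖toL2 Ω u‖ ^ 2 + ∑ i, ‖weakPartial i u‖ ^ 2 :=
  H1.norm_sq (H10.toH1 Ω u)

theorem H1.hasWeakPartial (u : H1 Ω) (i : Fin d) :
    HasWeakPartial Ω i (H1.toL2 Ω u) (H1.weakPartial Ω i u) :=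
  (u : weakGradientGraph Ω).2 i

theorem HasWeakPartial.eq_zero {i : Fin d} {g : L2 Ω} (h : HasWeakPartial Ω i 0 g) : g = 0 := by
  refine L2.eq_zero_of_forall_integral_mul_test fun φ => ?_
  rw [← neg_eq_zero, ← h φ]
  refine integral_eq_zero_of_ae ?_
  filter_upwards [Lp.coeFn_zero ℝ 2 (volume.restrict (Ω : Set (EucSp d)))] with x hx
  rw [hx, Pi.zero_apply, zero_mul]

/-- Elements carry their gradient as data, so injectivity amounts to uniqueness of the weak gradient
of `0`. -/
theorem toL2_injective (Ω : Opens (EucSp d)) : Function.Injective (toL2 Ω) := by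
  refine (injective_iff_map_eq_zero _).2 fun u hu => ?_
  have hg : ∀ i, weakPartial i u = 0 := fun i => by
    have h := H1.hasWeakPartial (H10.toH1 Ω u) i
    rw [show H1.toL2 Ω (H10.toH1 Ω u) = 0 from hu] at h
    exact h.eq_zero
  have h := H10.norm_sq u
  simp only [hu, hg, norm_zero] at h
  exact norm_eq_zero.1 (by simpa using h)

theorem hasWeakPartial_test (φ : 𝓓(Ω, ℝ)) (i : Fin d)
    (h : MemLp φ 2 (volume.restrict (Ω : Set (EucSp d))))
    (h' : MemLp (fun x => fderiv ℝ φ x (EuclideanSpace.single i 1)) 2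
      (volume.restrict (Ω : Set (EucSp d)))) :
    HasWeakPartial Ω i h.toLp h'.toLp := by
  intro ψ
  have hd : ∀ χ : 𝓓(Ω, ℝ), Continuous fun x => fderiv ℝ χ x (EuclideanSpace.single i 1) :=
    fun χ => (χ.contDiff.continuous_fderiv (by simp)).clm_apply continuous_const
  have hz : ∀ x ∉ (Ω : Set (EucSp d)), ψ x = 0 := fun x hx =>
    image_eq_zero_of_notMem_tsupport fun hm => hx (ψ.tsupport_subset hm)
  have hz' : ∀ x ∉ (Ω : Set (EucSp d)), fderiv ℝ ψ x (EuclideanSpace.single i 1) = 0 :=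
    fun x hx => by
      rw [image_eq_zero_of_notMem_tsupport (f := fderiv ℝ ψ)
        fun hm => hx (ψ.tsupport_subset (tsupport_fderiv_subset ℝ hm)), zero_apply]
  have e1 : ∫ x in (Ω : Set (EucSp d)),
      (MemLp.toLp φ h : L2 Ω) x * fderiv ℝ ψ x (EuclideanSpace.single i 1) =
      ∫ x, φ x * fderiv ℝ ψ x (EuclideanSpace.single i 1) := by
    refine Eq.trans (integral_congr_ae (h.coeFn_toLp.mono fun x hx => by simp only [hx]))
      (setIntegral_eq_integral_of_forall_compl_eq_zero fun x hx => by rw [hz' x hx, mul_zero])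
  have e2 : ∫ x in (Ω : Set (EucSp d)), (MemLp.toLp _ h' : L2 Ω) x * ψ x =
      ∫ x, fderiv ℝ φ x (EuclideanSpace.single i 1) * ψ x := by
    refine Eq.trans (integral_congr_ae (h'.coeFn_toLp.mono fun x hx => by simp only [hx]))
      (setIntegral_eq_integral_of_forall_compl_eq_zero fun x hx => by rw [hz x hx, mul_zero])
  rw [e1, e2]
  exact integral_mul_fderiv_eq_neg_fderiv_mul_of_integrable
    (((hd φ).mul ψ.continuous).integrable_of_hasCompactSupport ψ.hasCompactSupport.mul_left)
    ((φ.continuous.mul (hd ψ)).integrable_of_hasCompactSupport φ.hasCompactSupport.mul_right)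
    ((φ.continuous.mul ψ.continuous).integrable_of_hasCompactSupport φ.hasCompactSupport.mul_right)
    (fun x _ => φ.contDiff.differentiable (by simp) x)
    (fun x _ => ψ.contDiff.differentiable (by simp) x)

theorem exists_toL2_ae_eq_test (φ : 𝓓(Ω, ℝ)) :
    ∃ u : H10 Ω, toL2 Ω u =ᵐ[volume.restrict (Ω : Set (EucSp d))] φ := by
  have h : MemLp φ 2 (volume.restrict (Ω : Set (EucSp d))) :=
    φ.continuous.memLp_of_hasCompactSupport φ.hasCompactSupport
  have h' : ∀ i : Fin d, MemLp (fun x => fderiv ℝ φ x (EuclideanSpace.single i 1)) 2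
      (volume.restrict (Ω : Set (EucSp d))) := fun i =>
    ((φ.contDiff.continuous_fderiv (by simp)).clm_apply continuous_const).memLp_of_hasCompactSupport
      (φ.hasCompactSupport.fderiv_apply ℝ _)
  let u : H1 Ω := (⟨WithLp.toLp 2 (h.toLp, WithLp.toLp 2 fun i => (h' i).toLp),
    fun i => hasWeakPartial_test φ i h (h' i)⟩ : weakGradientGraph Ω)
  have hu : u ∈ testSubspace Ω := ⟨φ, h.coeFn_toLp⟩
  exact ⟨(⟨u, subset_closure hu⟩ : (testSubspace Ω).topologicalClosure), h.coeFn_toLp⟩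

/-- The range contains all test functions, and an `L²` function orthogonal to these is zero. -/
theorem denseRange_toL2 (Ω : Opens (EucSp d)) : DenseRange (toL2 Ω) := by
  refine denseRange_of_forall_inner_eq_zero fun x hx => ?_
  refine L2.eq_zero_of_forall_integral_mul_test fun φ => ?_
  obtain ⟨u, hu⟩ := exists_toL2_ae_eq_test φ
  rw [← hx u, real_inner_comm, L2.inner_def]
  refine integral_congr_ae (hu.mono fun t ht => ?_)
  simp only [ht]
  rfl

end SobolevSpaces

/-! ### Ellipticity of the coefficient matrix. -/

section BilinearForm

open scoped RealInnerProductSpace Matrix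

theorem Matrix.PosDef.exists_le_sum_inner {d : ℕ} {P : Matrix (Fin d) (Fin d) ℝ} (hP : P.PosDef)
    (E : Type*) [NormedAddCommGroup E] [InnerProductSpace ℝ E] :
    ∃ β > 0, ∀ g : Fin d → E, β * ∑ i, ‖g i‖ ^ 2 ≤ ∑ i, ∑ j, P i j * ⟪g i, g j⟫ := by
  obtain ⟨C, hC⟩ : ∃ C : Matrix (Fin d) (Fin d) ℝ, P = Cᵀ * C := by
    open scoped MatrixOrder in
    obtain ⟨C, hC⟩ := CStarAlgebra.nonneg_iff_eq_star_mul_self.mp hP.posSemidef.nonneg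
    exact ⟨C, by rw [hC, Matrix.star_eq_conjTranspose, Matrix.conjTranspose_eq_transpose_of_trivial]⟩
  have hCu : IsUnit C.det := by
    have h := (Matrix.isUnit_iff_isUnit_det P).1 hP.isUnit
    rw [hC, Matrix.det_mul] at h
    exact isUnit_of_mul_isUnit_right h
  have hinv : C⁻¹ * C = 1 := Matrix.nonsing_inv_mul C hCu
  -- With `P = Cᵀ C` the form is `∑ ‖h k‖²` for `h = C g`. Recovering `g = C⁻¹ h` by Cauchy-Schwarz
  -- costs the squared Frobenius norm `K`, which is `0` when `d = 0`; hence `K + 1` below.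
  set K := ∑ i, ∑ k, C⁻¹ i k ^ 2
  have hK : 0 ≤ K := Finset.sum_nonneg fun i _ => Finset.sum_nonneg fun k _ => sq_nonneg _
  refine ⟨1 / (K + 1), by positivity, fun g => ?_⟩
  let h : Fin d → E := fun k => ∑ i, C k i • g i
  have hsum : ∑ i, ∑ j, P i j * ⟪g i, g j⟫ = ∑ k, ‖h k‖ ^ 2 := by
    have hk : ∀ k, ‖h k‖ ^ 2 = ∑ i, ∑ j, C k i * C k j * ⟪g i, g j⟫ := fun k => by
      simp_rw [← real_inner_self_eq_norm_sq, h, sum_inner, inner_sum, real_inner_smul_left,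
        real_inner_smul_right, mul_assoc]
    simp_rw [hk]
    refine (Finset.sum_comm.trans (Finset.sum_congr rfl fun i _ =>
      Finset.sum_comm.trans (Finset.sum_congr rfl fun j _ => ?_))).symm
    rw [hC, Matrix.mul_apply, Finset.sum_mul]
    rfl
  have hg : ∀ i, g i = ∑ k, C⁻¹ i k • h k := fun i => by
    simp_rw [h, Finset.smul_sum, smul_smul]
    rw [Finset.sum_comm]
    simp_rw [← Finset.sum_smul, ← Matrix.mul_apply, hinv, Matrix.one_apply, ite_smul, one_smul,
      zero_smul]
    simp
  have hle : ∑ i, ‖g i‖ ^ 2 ≤ K * ∑ k, ‖h k‖ ^ 2 := by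
    rw [Finset.sum_mul]
    refine Finset.sum_le_sum fun i _ => ?_
    have h1 : ‖g i‖ ≤ ∑ k, |C⁻¹ i k| * ‖h k‖ := by
      conv_lhs => rw [hg i]
      exact (norm_sum_le _ _).trans_eq (by simp [norm_smul])
    calc ‖g i‖ ^ 2 ≤ (∑ k, |C⁻¹ i k| * ‖h k‖) ^ 2 := by gcongr
      _ ≤ (∑ k, |C⁻¹ i k| ^ 2) * ∑ k, ‖h k‖ ^ 2 := Finset.sum_mul_sq_le_sq_mul_sq _ _ _
      _ = _ := by simp_rw [sq_abs]
  rw [hsum, one_div, inv_mul_le_iff₀ (by positivity)]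
  have : 0 ≤ ∑ k, ‖h k‖ ^ 2 := Finset.sum_nonneg fun k _ => sq_nonneg _
  linarith

theorem exists_le_sum_coeffP {d : ℕ} {ρ : Matrix (Fin d) (Fin d) ℝ} {σ xmin xmax : Fin d → ℝ}
    (hQ : (covarianceMatrix ρ σ).PosDef) (hx : ∀ i, xmin i < xmax i)
    (E : Type*) [NormedAddCommGroup E] [InnerProductSpace ℝ E] :
    ∃ β > 0, ∀ g : Fin d → E,
      β * ∑ i, ‖g i‖ ^ 2 ≤ ∑ i, ∑ j, coeffP ρ σ xmin xmax i j * ⟪g i, g j⟫ := by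
  obtain ⟨β, hβ, h⟩ := hQ.exists_le_sum_inner E
  have hD : ∀ i, 0 < xmax i - xmin i := fun i => sub_pos.2 (hx i)
  set S := ∑ i, (xmax i - xmin i) ^ 2
  have hS : 0 ≤ S := Finset.sum_nonneg fun i _ => sq_nonneg _
  refine ⟨β / (2 * (S + 1)), by positivity, fun g => ?_⟩
  -- Rescaling by the side lengths turns the covariance matrix into `coeffP`, up to the factor `2`.
  have hg := h fun i => (xmax i - xmin i)⁻¹ • g i
  have e : ∑ i, ∑ j, coeffP ρ σ xmin xmax i j * ⟪g i, g j⟫ =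
      (∑ i, ∑ j, covarianceMatrix ρ σ i j *
        ⟪(xmax i - xmin i)⁻¹ • g i, (xmax j - xmin j)⁻¹ • g j⟫) / 2 := by
    rw [Finset.sum_div]
    refine Finset.sum_congr rfl fun i _ => ?_
    rw [Finset.sum_div]
    refine Finset.sum_congr rfl fun j _ => ?_
    have := (hD i).ne'
    have := (hD j).ne'
    simp only [coeffP, covarianceMatrix, Matrix.of_apply, real_inner_smul_left,
      real_inner_smul_right]
    field_simp
  have hle : ∑ i, ‖g i‖ ^ 2 ≤ (S + 1) * ∑ i, ‖(xmax i - xmin i)⁻¹ • g i‖ ^ 2 := by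
    rw [Finset.mul_sum]
    refine Finset.sum_le_sum fun i _ => ?_
    have h1 : (xmax i - xmin i) ^ 2 ≤ S + 1 := by
      have := Finset.single_le_sum (f := fun i => (xmax i - xmin i) ^ 2)
        (fun i _ => sq_nonneg _) (Finset.mem_univ i)
      simp only [S]
      linarith
    calc ‖g i‖ ^ 2 = (xmax i - xmin i) ^ 2 * ‖(xmax i - xmin i)⁻¹ • g i‖ ^ 2 := by
          rw [norm_smul, Real.norm_of_nonneg (inv_pos.2 (hD i)).le]
          have := (hD i).ne'
          field_simp
      _ ≤ _ := by gcongr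
  rw [e, div_mul_eq_mul_div, div_le_div_iff₀ (by positivity) two_pos]
  nlinarith [mul_le_mul_of_nonneg_left hle hβ.le]

end BilinearForm

/-! ### Transfer between the abstract and the concrete problem. -/

section VariationalSolution

open scoped RealInnerProductSpace ContDiff

variable {d : ℕ} {Ω : Opens (EucSp d)}

/-- The bounded bilinear form `(u, v) ↦ ⟨A u, B v⟩`. -/
noncomputable def innerFormCLM {X Y : Type*} [NormedAddCommGroup X] [NormedSpace ℝ X]
    [NormedAddCommGroup Y] [InnerProductSpace ℝ Y] (A B : X →L[ℝ] Y) : X →L[ℝ] StrongDual ℝ X :=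
  ContinuousLinearMap.bilinearComp (innerSL ℝ : Y →L[ℝ] Y →L[ℝ] ℝ) A B

/-- The bilinear form `a` as a continuous linear map `H_0^1(Ω) → H^{-1}(Ω)`. -/
noncomputable def bilinFormCLM (Ω : Opens (EucSp d)) (P : Matrix (Fin d) (Fin d) ℝ) (r : ℝ) :
    H10 Ω →L[ℝ] Hneg1 Ω :=
  (∑ i, ∑ j, P i j • innerFormCLM ((H1.weakPartial Ω i).comp (H10.toH1 Ω))
    ((H1.weakPartial Ω j).comp (H10.toH1 Ω))) + r • innerFormCLM (toL2 Ω) (toL2 Ω)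

theorem bilinFormCLM_apply (P : Matrix (Fin d) (Fin d) ℝ) (r : ℝ) (u v : H10 Ω) :
    bilinFormCLM Ω P r u v = bilinForm P r u v := by
  simp only [bilinFormCLM, bilinForm, add_apply, sum_apply, smul_apply, smul_eq_mul]
  rfl

/-- The Gårding inequality for the bilinear form. -/
theorem bilinForm_garding {ρ : Matrix (Fin d) (Fin d) ℝ} {σ xmin xmax : Fin d → ℝ}
    (hQ : (covarianceMatrix ρ σ).PosDef) (hx : ∀ i, xmin i < xmax i) (r : ℝ) :
    ∃ α > 0, ∃ s : ℝ, ∀ v : H10 Ω,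
      α * ‖v‖ ^ 2 ≤ bilinForm (coeffP ρ σ xmin xmax) r v v + s * ‖toL2 Ω v‖ ^ 2 := by
  obtain ⟨β, hβ, h⟩ := exists_le_sum_coeffP hQ hx (L2 Ω)
  -- The shift cancels `r` and supplies the term `β ‖v‖²` in `L²` that the gradient part leaves out.
  refine ⟨β, hβ, β - r, fun v => ?_⟩
  have hv := h fun i => weakPartial i v
  rw [H10.norm_sq, bilinForm, real_inner_self_eq_norm_sq]
  linarith

variable {T : ℝ}

theorem integrable_smul_clm_timeInterval {X Y : Type*} [NormedAddCommGroup X] [NormedSpace ℝ X]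
    [NormedAddCommGroup Y] [NormedSpace ℝ Y] {ψ : ℝ → ℝ} (hψ : Continuous ψ) (L : X →L[ℝ] Y)
    (f : Lp X 2 (volume.restrict (timeInterval T : Set ℝ))) :
    Integrable (fun t => ψ t • L (f t)) (volume.restrict (timeInterval T : Set ℝ)) := by
  obtain ⟨C, hC⟩ := exists_bound_timeInterval hψ T
  exact (L.integrable_comp ((Lp.memLp f).integrable one_le_two)).bdd_smul C
    hψ.aestronglyMeasurable hC

theorem testFunction_continuous_deriv (φ : 𝓓(timeInterval T, ℝ)) : Continuous (deriv φ) :=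
  φ.contDiff.continuous_deriv (by simp)

theorem integral_deriv_smul_toHneg1_apply (φ : 𝓓(timeInterval T, ℝ)) (u : BochnerL2 T (H10 Ω))
    (v : H10 Ω) :
    (∫ t in (timeInterval T : Set ℝ), deriv φ t • toHneg1 (u t)) v =
      ∫ t in (timeInterval T : Set ℝ), deriv φ t * ⟪toL2 Ω v, toL2 Ω (u t)⟫ := by
  refine (ContinuousLinearMap.integral_apply (integrable_smul_clm_timeInterval
    (testFunction_continuous_deriv φ) (innerFormCLM (toL2 Ω) (toL2 Ω)) u) v).trans ?_
  refine integral_congr_ae (.of_forall fun t => ?_)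
  exact congrArg (deriv φ t * ·) (real_inner_comm (toL2 Ω v) (toL2 Ω (u t)))

theorem integral_smul_Hneg1_apply (φ : 𝓓(timeInterval T, ℝ)) (w : BochnerL2 T (Hneg1 Ω))
    (v : H10 Ω) :
    (∫ t in (timeInterval T : Set ℝ), φ t • w t) v =
      ∫ t in (timeInterval T : Set ℝ), φ t * w t v :=
  ContinuousLinearMap.integral_apply (integrable_smul_clm_timeInterval φ.continuous
    (ContinuousLinearMap.id ℝ _) w) v

/-- Eliminates the time derivative `w`, leaving the scalar weak form used in the abstract theorems.
-/
theorem IsVariationalSolution.integral_deriv_mul_inner {P : Matrix (Fin d) (Fin d) ℝ} {r : ℝ}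
    {u₀ : L2 Ω} {u : BochnerL2 T (H10 Ω)} (h : IsVariationalSolution P r u₀ u)
    (φ : 𝓓(timeInterval T, ℝ)) (v : H10 Ω) :
    ∫ t in (timeInterval T : Set ℝ), deriv φ t * ⟪toL2 Ω v, toL2 Ω (u t)⟫ =
      ∫ t in (timeInterval T : Set ℝ), φ t * bilinFormCLM Ω P r (u t) v := by
  obtain ⟨w, hw, heq⟩ := h.equation
  rw [← integral_deriv_smul_toHneg1_apply, hw φ, neg_apply, integral_smul_Hneg1_apply,
    ← integral_neg]
  refine integral_congr_ae (heq.mono fun t ht => ?_)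
  simp only [bilinFormCLM_apply, eq_neg_of_add_eq_zero_left (ht v), mul_neg, neg_neg]

theorem IsVariationalSolution.unique {P : Matrix (Fin d) (Fin d) ℝ} {r s : ℝ}
    (ha : ∀ v : H10 Ω, 0 ≤ bilinForm P r v v + s * ‖toL2 Ω v‖ ^ 2) (hT : 0 < T)
    {u₀ : L2 Ω} {u₁ u₂ : BochnerL2 T (H10 Ω)} (h₁ : IsVariationalSolution P r u₀ u₁)
    (h₂ : IsVariationalSolution P r u₀ u₂) : u₁ = u₂ := by
  obtain ⟨c₁, hc₁, hcu₁, hi₁⟩ := h₁.initial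
  obtain ⟨c₂, hc₂, hcu₂, hi₂⟩ := h₂.initial
  -- The abstract theorem wants continuity on all of `ℝ`, so the difference is extended by constants
  -- from `[0,T]`.
  obtain ⟨c, hcc, hc⟩ : ∃ c : ℝ → L2 Ω, Continuous c ∧ ∀ t ∈ Icc 0 T, c t = c₁ t - c₂ t :=
    ⟨IccExtend hT.le ((Icc 0 T).domRestrict fun t => c₁ t - c₂ t),
      (continuousOn_iff_continuous_domRestrict.1 (hc₁.sub hc₂)).Icc_extend',
      fun t ht => IccExtend_of_mem hT.le _ ht⟩
  have hsub := Lp.coeFn_sub u₁ u₂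
  have hcu : ∀ᵐ t ∂(volume.restrict (timeInterval T : Set ℝ)), c t = toL2 Ω ((u₁ - u₂) t) := by
    filter_upwards [hcu₁, hcu₂, hsub, ae_mem_timeInterval T] with t h1 h2 h3 h4
    rw [hc t (Ioo_subset_Icc_self h4), h1, h2, h3, Pi.sub_apply, map_sub]
  rw [← sub_eq_zero]
  refine weak_solution_eq_zero (toL2_injective Ω) (a := bilinFormCLM Ω P r) (r := s)
    (fun v => by rw [bilinFormCLM_apply]; exact ha v) hT
    hcc (by rw [hc 0 (left_mem_Icc.2 hT.le), hi₁, hi₂, sub_self]) hcu fun φ v => ?_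
  have hl : ∀ u : BochnerL2 T (H10 Ω), Integrable
      (fun t => deriv φ t * ⟪toL2 Ω v, toL2 Ω (u t)⟫)
      (volume.restrict (timeInterval T : Set ℝ)) := fun u =>
    integrable_mul_dual_timeInterval (testFunction_continuous_deriv φ)
      ((innerSL ℝ (toL2 Ω v)).comp (toL2 Ω)) u
  have hr : ∀ u : BochnerL2 T (H10 Ω), Integrable (fun t => φ t * bilinFormCLM Ω P r (u t) v)
      (volume.restrict (timeInterval T : Set ℝ)) := fun u =>
    integrable_mul_dual_timeInterval φ.continuous ((bilinFormCLM Ω P r).flip v) u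
  have e := congrArg₂ (· - ·) (h₁.integral_deriv_mul_inner φ v) (h₂.integral_deriv_mul_inner φ v)
  simp only [← integral_sub (hl u₁) (hl u₂), ← integral_sub (hr u₁) (hr u₂)] at e
  refine Eq.trans (integral_congr_ae ?_) (e.trans (integral_congr_ae ?_))
  · filter_upwards [hcu, hsub] with t h1 h2
    rw [h1, h2, Pi.sub_apply, map_sub, inner_sub_right, mul_sub]
  · filter_upwards [hsub] with t h2
    rw [h2, Pi.sub_apply, map_sub, sub_apply, mul_sub]

theorem exists_isVariationalSolution {P : Matrix (Fin d) (Fin d) ℝ} {r s α : ℝ} (hα : 0 < α)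
    (ha : ∀ v : H10 Ω, α * ‖v‖ ^ 2 ≤ bilinForm P r v v + s * ‖toL2 Ω v‖ ^ 2) (hT : 0 ≤ T)
    (u₀ : L2 Ω) : ∃ u : BochnerL2 T (H10 Ω), IsVariationalSolution P r u₀ u := by
  obtain ⟨c, u, hc, hc0, hcu, hw⟩ := exists_weak_solution (denseRange_toL2 Ω)
    (a := bilinFormCLM Ω P r) (r := s) hα (fun v => by rw [bilinFormCLM_apply]; exact ha v) hT u₀
  have hcoe := (-bilinFormCLM Ω P r).coeFn_compLp u
  -- The equation dictates the time derivative `w = -a(u, ·)`, which lies in `L²(0,T;H⁻¹(Ω))`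
  -- because the form is bounded.
  refine ⟨u, ⟨(-bilinFormCLM Ω P r).compLp u, fun φ => ContinuousLinearMap.ext fun v => ?_, ?_⟩,
    c, hc.continuousOn, hcu, hc0⟩
  · have h0 : φ 0 = 0 := image_eq_zero_of_notMem_tsupport fun hm =>
      lt_irrefl _ (φ.tsupport_subset hm).1
    have h1 : φ T = 0 := image_eq_zero_of_notMem_tsupport fun hm =>
      lt_irrefl _ (φ.tsupport_subset hm).2
    have h := hw φ (φ.contDiff.of_le (by exact_mod_cast le_top)) h0 h1 v
    rw [integral_deriv_smul_toHneg1_apply, neg_apply, integral_smul_Hneg1_apply, ← integral_neg]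
    refine Eq.trans (integral_congr_ae ?_) (h.trans (integral_congr_ae ?_))
    · filter_upwards [hcu] with t ht
      rw [ht]
    · filter_upwards [hcoe] with t ht
      rw [ht, neg_apply, neg_apply, mul_neg, neg_neg]
  · filter_upwards [hcoe] with t ht v
    rw [ht, neg_apply, neg_apply, bilinFormCLM_apply, neg_add_cancel]

end VariationalSolution

theorem mainTheorem11 (d : ℕ) (ρ : Matrix (Fin d) (Fin d) ℝ) (σ : Fin d → ℝ)
    (hQ : (covarianceMatrix ρ σ).PosDef)
    (xmin xmax : Fin d → ℝ) (hx : ∀ i, xmin i < xmax i)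
    (r T : ℝ) (hT : 0 < T) (u₀ : L2 (unitCube d)) :
    ∃! u : BochnerL2 T (H10 (unitCube d)),
      IsVariationalSolution (coeffP ρ σ xmin xmax) r u₀ u := by
  obtain ⟨α, hα, s, hs⟩ := bilinForm_garding (Ω := unitCube d) hQ hx r
  obtain ⟨u, hu⟩ := exists_isVariationalSolution hα hs hT.le u₀
  exact ⟨u, hu, fun v hv =>
    hv.unique (fun w => (by positivity : 0 ≤ α * ‖w‖ ^ 2).trans (hs w)) hT hu⟩
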